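/- Let $G$ be a totally disconnected, second countable, locally compact group. For $1<p<\infty$, say that $G$ has Property $(T_{\ell_p})$ if, for every strongly continuous representation $\pi$ of $G$ by linear bijective isometries of the complex sequence space $\ell_p=\ell_p(\mathbf N)$, there is no sequence of unit vectors $f_n\in \ell_p'(\pi)$ with $\Vert\pi(g)f_n-f_n\Vert\to 0$ uniformly on compact subsets of $G$; here $\ell_p'(\pi)\subset\ell_p$ is the annihilator of the space of $\pi^*(G)$-invariant vectors of the dual space $\ell_p^*=\ell_q$, $1/p+1/q=1$, with $\pi^*$ the dual representation. The following properties are equivalent. (i) $G$ has Property $(T_{\ell_p})$ for some $p$ with $1<p<\infty$, $p\neq 2$. (i') $G$ has Property $(T_{\ell_p})$ for every $p$ with $1<p<\infty$, $p\neq 2$. (ii) $G$ has Property $(T;\mathcal R_{\rm quasi-reg})$, where $\mathcal R_{\rm quasi-reg}$ is the set of quasi-regular representations $(\lambda_{G/H},\ell_2(G/H))$ associated to the open subgroups $H$ of $G$; that is, if $\lambda_{G/H}'$ denotes the restriction of $\lambda_{G/H}$ to the orthogonal complement of its invariant vectors, then the Hilbert sum $\bigoplus_{H}\lambda_{G/H}'$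 over all open subgroups $H$ of $G$ has no sequence of unit vectors $f_n$ with $\Vert g f_n-f_n\Vert\to 0$ uniformly on compact subsets of $G$. -/

import Mathlib

open scoped ENNReal

/-! ### Isometric representations and almost invariant vectors -/

section Representations

variable {G : Type*} [Group G] {B : Type*} [NormedAddCommGroup B] [NormedSpace ℂ B]

/-- Strong continuity: all orbit maps `g ↦ π(g) f` are continuous. -/
def IsStronglyContinuous [TopologicalSpace G] (π : G →* (B ≃ₗᵢ[ℂ] B)) : Prop :=
  ∀ f : B, Continuous fun g : G => π g f

/-- The subspace `B^{π(G)}` of invariant vectors. -/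
def invariantVectors (π : G →* (B ≃ₗᵢ[ℂ] B)) : Submodule ℂ B where
  carrier := {f | ∀ g, π g f = f}
  zero_mem' := fun g => map_zero _
  add_mem' := fun {a b} ha hb g => by rw [map_add, ha g, hb g]
  smul_mem' := fun c f hf g => by rw [map_smul, hf g]

/-- The isometry of the dual space given by `φ ↦ φ ∘ U⁻¹`. -/
noncomputable def dualIsometry (U : B ≃ₗᵢ[ℂ] B) : StrongDual ℂ B ≃ₗᵢ[ℂ] StrongDual ℂ B where
  toFun φ := φ.comp (U.symm : B →L[ℂ] B)
  invFun φ := φ.comp (U : B →L[ℂ] B)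
  map_add' _ _ := rfl
  map_smul' _ _ := rfl
  left_inv φ := by ext x; simp
  right_inv φ := by ext x; simp
  norm_map' φ := ContinuousLinearMap.opNorm_comp_linearIsometryEquiv φ U.symm

/-- The dual representation `π* : G → O(B*)`, `π*(g) φ = φ ∘ π(g)⁻¹`. -/
noncomputable def dualRep (π : G →* (B ≃ₗᵢ[ℂ] B)) :
    G →* (StrongDual ℂ B ≃ₗᵢ[ℂ] StrongDual ℂ B) where
  toFun g := dualIsometry (π g)
  map_one' := by ext φ x; simp [dualIsometry]; rfl
  map_mul' g h := by ext φ x; simp [dualIsometry]; rfl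

/-- The complement `B'(π)`: the annihilator in `B` of the `π*(G)`-invariant vectors of `B*`. -/
def dualInvariantsAnnihilator (π : G →* (B ≃ₗᵢ[ℂ] B)) : Submodule ℂ B where
  carrier := {f | ∀ φ ∈ invariantVectors (dualRep π), φ f = 0}
  zero_mem' := fun φ _ => map_zero φ
  add_mem' := fun {a b} ha hb φ hφ => by rw [map_add, ha φ hφ, hb φ hφ, add_zero]
  smul_mem' := fun c f hf φ hφ => by rw [map_smul, hf φ hφ, smul_zero]

/-- The subspace `W` contains a sequence of almost invariant vectors for `π`: unit vectors `f n`
with `‖π(g) (f n) - f n‖ → 0` uniformly on compact subsets of `G`. -/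
def HasAlmostInvariantVectorsIn [TopologicalSpace G] (π : G →* (B ≃ₗᵢ[ℂ] B))
    (W : Submodule ℂ B) : Prop :=
  ∃ f : ℕ → B, (∀ n, f n ∈ W) ∧ (∀ n, ‖f n‖ = 1) ∧
    ∀ K : Set G, IsCompact K →
      TendstoUniformlyOn (fun n g => ‖π g (f n) - f n‖) (fun _ => 0) Filter.atTop K

/-- The restriction of a representation to an invariant subspace. -/
def subRep (π : G →* (B ≃ₗᵢ[ℂ] B)) (W : Submodule ℂ B) (hW : ∀ g, ∀ f ∈ W, π g f ∈ W) :
    G →* (W ≃ₗᵢ[ℂ] W) where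
  toFun g :=
    { toFun := fun f => ⟨π g f, hW g f f.2⟩
      invFun := fun f => ⟨π g⁻¹ f, hW g⁻¹ f f.2⟩
      map_add' := fun a b => Subtype.ext (map_add (π g) _ _)
      map_smul' := fun c a => Subtype.ext (map_smul (π g) _ _)
      left_inv := fun f => Subtype.ext (by simp)
      right_inv := fun f => Subtype.ext (by simp)
      norm_map' := fun f => (π g).norm_map f }
  map_one' := by ext f; simp
  map_mul' g h := by ext f; simp

end Representations

/-- Property `(T_B)`: no strongly continuous representation of `G` on `B` by linear bijective
isometries has a sequence of almost invariant vectors in the complement `B'(π)`. -/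
def PropertyTB (G : Type*) [Group G] [TopologicalSpace G]
    (B : Type*) [NormedAddCommGroup B] [NormedSpace ℂ B] : Prop :=
  ∀ π : G →* (B ≃ₗᵢ[ℂ] B), IsStronglyContinuous π →
    ¬ HasAlmostInvariantVectorsIn π (dualInvariantsAnnihilator π)

/-- Property `(T_{ℓ_p})`, for the complex sequence space `ℓ_p = ℓ_p(ℕ)`. -/
def PropertyTlp (G : Type*) [Group G] [TopologicalSpace G] (p : ℝ≥0∞) [Fact (1 ≤ p)] : Prop :=
  PropertyTB G (lp (fun _ : ℕ => ℂ) p)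

/-! ### Hilbert sums of unitary representations and Property `(T; R)` -/

section Unitary

variable {G : Type*} [Group G]

/-- The coordinatewise isometry `(f_i) ↦ (U_i f_i)` of a Hilbert sum. -/
def hilbertSumIsometry {ι : Type*} {E : ι → Type*} [∀ i, NormedAddCommGroup (E i)]
    [∀ i, NormedSpace ℂ (E i)] (U : ∀ i, E i ≃ₗᵢ[ℂ] E i) : lp E 2 ≃ₗᵢ[ℂ] lp E 2 where
  toFun f := ⟨fun i => U i (f i), (lp.memℓp f).norm.mono fun i => by simp⟩
  invFun f := ⟨fun i => (U i).symm (f i), (lp.memℓp f).norm.mono fun i => by simp⟩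
  map_add' a b := Subtype.ext (funext fun i => map_add (U i) (a i) (b i))
  map_smul' c a := Subtype.ext (funext fun i => map_smul (U i) c (a i))
  left_inv f := by ext i; simp
  right_inv f := by ext i; simp
  norm_map' f := by
    have h2 : 0 < (2 : ℝ≥0∞).toReal := by norm_num
    simp [lp.norm_eq_tsum_rpow h2]

/-- The Hilbert direct sum `⊕ π_i`. -/
def hilbertSumRep {ι : Type*} {E : ι → Type*} [∀ i, NormedAddCommGroup (E i)]
    [∀ i, NormedSpace ℂ (E i)] (π : ∀ i, G →* (E i ≃ₗᵢ[ℂ] E i)) :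
    G →* (lp E 2 ≃ₗᵢ[ℂ] lp E 2) where
  toFun g := hilbertSumIsometry fun i => π i g
  map_one' := by ext f i; simp [hilbertSumIsometry]
  map_mul' g h := by ext f i; simp [hilbertSumIsometry]

variable {E : Type*} [NormedAddCommGroup E] [InnerProductSpace ℂ E]

theorem map_mem_invariantVectors_orthogonal (π : G →* (E ≃ₗᵢ[ℂ] E)) (g : G) :
    ∀ f ∈ (invariantVectors π)ᗮ, π g f ∈ (invariantVectors π)ᗮ := by
  intro f hf
  rw [Submodule.mem_orthogonal] at hf ⊢
  intro u hu
  have h : inner ℂ (π g u) (π g f) = inner ℂ u f := (π g).inner_map_map u f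
  rw [hu g] at h
  rw [h, hf u hu]

/-- The restriction `π'` of `π` to the orthogonal complement of the invariant vectors. -/
noncomputable def complementRep (π : G →* (E ≃ₗᵢ[ℂ] E)) :
    G →* ((invariantVectors π)ᗮ ≃ₗᵢ[ℂ] (invariantVectors π)ᗮ) :=
  subRep π (invariantVectors π)ᗮ (map_mem_invariantVectors_orthogonal π)

/-- Property `(T; R)` for a family `R = (π_i)` of unitary representations on Hilbert spaces: the
Hilbert sum `⊕ π_i'` has no sequence of almost invariant vectors. -/
def PropertyTR {G : Type*} [Group G] [TopologicalSpace G] {ι : Type*} {E : ι → Type*}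
    [∀ i, NormedAddCommGroup (E i)] [∀ i, InnerProductSpace ℂ (E i)] [∀ i, CompleteSpace (E i)]
    (π : ∀ i, G →* (E i ≃ₗᵢ[ℂ] E i)) : Prop :=
  ¬ HasAlmostInvariantVectorsIn (hilbertSumRep fun i => complementRep (π i)) ⊤

end Unitary

/-! ### Quasi-regular representations -/

section QuasiRegular

/-- The isometry `f ↦ f ∘ σ` of `ℓ_2(X)`, for a permutation `σ` of `X`. -/
def permIsometry {X : Type*} (σ : Equiv.Perm X) :
    lp (fun _ : X => ℂ) 2 ≃ₗᵢ[ℂ] lp (fun _ : X => ℂ) 2 :=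
  have h2 : 0 < (2 : ℝ≥0∞).toReal := by norm_num
  have key : ∀ (τ : Equiv.Perm X) (f : lp (fun _ : X => ℂ) 2),
      Memℓp (fun x => f (τ x)) 2 := fun τ f =>
    (memℓp_gen_iff h2).2 (τ.summable_iff.2 ((memℓp_gen_iff h2).1 (lp.memℓp f)))
  { toFun := fun f => ⟨fun x => f (σ x), key σ f⟩
    invFun := fun f => ⟨fun x => f (σ.symm x), key σ.symm f⟩
    map_add' := fun _ _ => rfl
    map_smul' := fun _ _ => rfl
    left_inv := fun f => by ext x; simp
    right_inv := fun f => by ext x; simp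
    norm_map' := fun f => by
      rw [lp.norm_eq_tsum_rpow h2, lp.norm_eq_tsum_rpow h2]
      congr 1
      exact σ.tsum_eq fun x => ‖f x‖ ^ (2 : ℝ≥0∞).toReal }

/-- The quasi-regular representation `λ_{G/H}` on `ℓ_2(G/H)`:
`(λ_{G/H}(g) f)(x) = f(g⁻¹ x)`. For `H` open it is the representation of `G` on `L_2(G/H)`, since
`G/H` is discrete and the counting measure is the invariant measure. -/
def quasiRegularRep {G : Type*} [Group G] (H : Subgroup G) :
    G →* (lp (fun _ : G ⧸ H => ℂ) 2 ≃ₗᵢ[ℂ] lp (fun _ : G ⧸ H => ℂ) 2) where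
  toFun g := permIsometry (MulAction.toPerm g⁻¹)
  map_one' := by ext f x; simp [permIsometry]
  map_mul' g h := by ext f x; simp [permIsometry, mul_smul]

end QuasiRegular

/-! Fix a compact open subgroup `U`, which exists by van Dantzig's theorem. Both properties fail
exactly when `HasAlmostInvariantCosetFunctions U` holds: for every finite set and every `ε` there is
a `U`-invariant square-summable function on some `G ⧸ H`, `H` open, of mean zero when the index is
finite, which the finite set moves by less than `ε` in relative energy. Exact `U`-invariance makes
finite sets suffice, since a compact set meets only finitely many cosets of `U`. This condition does
not mention `p`, which gives independence of `p`.

On the Hilbert side, energies add over direct summands and over orbits, so a strict inequality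
between total energies survives on one summand or one orbit. Vectors are made exactly `U`-fixed by
taking the point of least norm in a `U`-invariant closed convex set.

The link between `ℓ_2` and `ℓ_p` is the Mazur map `v ↦ v ‖v‖ ^ (t - 1)` applied coordinatewise: it
carries unit vectors to unit vectors, is uniformly continuous on bounded sets, and commutes with
permutations and with unimodular factors. Coset functions thus give almost invariant vectors for a
permutation representation on `ℓ_p` of the disjoint union of countably many coset spaces. The Mazur
map spoils mean zero, but the image stays uniformly far from the constants, so its mean can be
subtracted.

Conversely, for `p ≠ 2` the Banach–Lamperti theorem makes every isometric representation on `ℓ_p`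
monomial, that is, given by an action on `X × Circle` commuting with `Circle`. Strong continuity
makes the stabilizers open, because the circle has no small subgroups. The Mazur map leads to the
monomial representation on `ℓ_2`, and a duality argument bounds the distance to its invariant
vectors from below.

It remains to remove the phases. Above the chosen orbit in `X`, if `X × Circle` contains a finite
orbit, the homogeneous function `twist w` restricts to it with mean zero. Otherwise all orbits above
it are infinite and no mean condition is needed; the phase is then replaced by an almost invariant
element of `ℓ_2` of the discrete circle, which exists because abelian groups are amenable. -/

theorem exists_pos_ofReal_le {ε : ℝ≥0∞} (hε : ε ≠ 0) :
    ∃ e : ℝ, 0 < e ∧ ENNReal.ofReal e ≤ ε := by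
  obtain ⟨e, he, heε⟩ := ENNReal.lt_iff_exists_nnreal_btwn.1 (pos_iff_ne_zero.2 hε)
  exact ⟨e, by exact_mod_cast he, by simpa using heε.le⟩

/-! ### Energies -/

section Energy

variable {X Y : Type*}

/-- The `r`-energy `∑ ‖f x‖ ^ r`. -/
noncomputable def energy (r : ℝ) (f : X → ℂ) : ℝ≥0∞ := ∑' x, ‖f x‖ₑ ^ r

theorem lp.enorm_rpow_eq_tsum {ι : Type*} {E : ι → Type*} [∀ i, NormedAddCommGroup (E i)]
    {p : ℝ≥0∞} [Fact (1 ≤ p)] (hp : 0 < p.toReal) (f : lp E p) :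
    ‖f‖ₑ ^ p.toReal = ∑' i, ‖f i‖ₑ ^ p.toReal := by
  have h := lp.norm_rpow_eq_tsum hp f
  have hs := (lp.memℓp f).summable hp
  have h0 : 0 ≤ p.toReal := hp.le
  calc ‖f‖ₑ ^ p.toReal = ENNReal.ofReal (‖f‖ ^ p.toReal) := by
        rw [← ENNReal.ofReal_rpow_of_nonneg (norm_nonneg _) h0, ofReal_norm]
    _ = ∑' i, ENNReal.ofReal (‖f i‖ ^ p.toReal) := by
        rw [h, ENNReal.ofReal_tsum_of_nonneg (fun i => by positivity) hs]
    _ = _ := by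
        congr 1; ext i
        rw [← ENNReal.ofReal_rpow_of_nonneg (norm_nonneg _) h0, ofReal_norm]

theorem memℓp_iff_tsum_enorm_ne_top {ι : Type*} {E : ι → Type*} [∀ i, NormedAddCommGroup (E i)]
    {p : ℝ≥0∞} (hp : 0 < p.toReal) (f : ∀ i, E i) :
    Memℓp f p ↔ ∑' i, ‖f i‖ₑ ^ p.toReal ≠ ⊤ := by
  rw [memℓp_gen_iff hp]
  have h : ∀ i, ‖f i‖ₑ ^ p.toReal = ((‖f i‖₊ ^ p.toReal : NNReal) : ℝ≥0∞) := fun i => by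
    rw [ENNReal.coe_rpow_of_nonneg _ hp.le]; rfl
  simp_rw [h]
  rw [ENNReal.tsum_coe_ne_top_iff_summable_coe]
  simp

theorem lp.energy_eq {p : ℝ≥0∞} [Fact (1 ≤ p)] (hp : 0 < p.toReal) (f : lp (fun _ : X => ℂ) p) :
    energy p.toReal f = ‖f‖ₑ ^ p.toReal := (lp.enorm_rpow_eq_tsum hp f).symm

theorem memℓp_iff_energy_ne_top {p : ℝ≥0∞} (hp : 0 < p.toReal) (f : X → ℂ) :
    Memℓp f p ↔ energy p.toReal f ≠ ⊤ := memℓp_iff_tsum_enorm_ne_top hp f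

theorem energy_comp_equiv (r : ℝ) (e : Y ≃ X) (f : X → ℂ) :
    energy r (fun y => f (e y)) = energy r f :=
  e.tsum_eq fun x => ‖f x‖ₑ ^ r

theorem energy_congr_norm {r : ℝ} {f g : X → ℂ} (h : ∀ x, ‖f x‖ = ‖g x‖) :
    energy r f = energy r g := by
  unfold energy
  congr 1; ext x
  rw [← ofReal_norm, ← ofReal_norm, h]

theorem energy_sub_le {r : ℝ} (hr : 1 ≤ r) (f g : X → ℂ) :
    energy r (fun x => f x - g x) ≤ 2 ^ (r - 1) * (energy r f + energy r g) := by
  unfold energy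
  rw [← ENNReal.tsum_add, ← ENNReal.tsum_mul_left]
  refine ENNReal.tsum_le_tsum fun x => ?_
  refine (ENNReal.rpow_le_rpow (enorm_sub_le) (by linarith)).trans ?_
  exact ENNReal.rpow_add_le_mul_rpow_add_rpow _ _ hr

/-- If one nonnegative sum is less than another, then the same holds on some fibre of any map. -/
theorem exists_fiber_tsum_lt {Q : Type*} {a b : X → ℝ≥0∞} (q : X → Q)
    (h : ∑' x, a x < ∑' x, b x) :
    ∃ c, ∑' x : q ⁻¹' {c}, a x < ∑' x : q ⁻¹' {c}, b x := by
  by_contra! hc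
  rw [← ENNReal.tsum_fiberwise a q, ← ENNReal.tsum_fiberwise b q] at h
  exact absurd h (not_lt.2 (ENNReal.tsum_le_tsum hc))

end Energy

/-! ### The Mazur map -/

section Mazur

/-- The Mazur map `v ↦ v ‖v‖ ^ (t - 1)`. -/
noncomputable def mazur (t : ℝ) (v : ℂ) : ℂ := ((‖v‖ ^ (t - 1) : ℝ) : ℂ) * v

theorem norm_mazur {t : ℝ} (ht : 0 < t) (v : ℂ) : ‖mazur t v‖ = ‖v‖ ^ t := by
  rcases eq_or_ne v 0 with rfl | hv
  · simp [mazur, Real.zero_rpow ht.ne']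
  · have : 0 < ‖v‖ := norm_pos_iff.2 hv
    rw [mazur, norm_mul, Complex.norm_real, Real.norm_of_nonneg (by positivity),
      ← Real.rpow_add_one this.ne', sub_add_cancel]

theorem mazur_zero (t : ℝ) : mazur t 0 = 0 := by simp [mazur]

theorem mazur_circle_mul (t : ℝ) (z : Circle) (v : ℂ) : mazur t (z * v) = z * mazur t v := by
  simp only [mazur, norm_mul, Circle.norm_coe, one_mul]; ring

theorem mazur_real_mul {t m : ℝ} (hm : 0 < m) (v : ℂ) :
    mazur t (m * v) = ((m ^ t : ℝ) : ℂ) * mazur t v := by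
  simp only [mazur, norm_mul, Complex.norm_real, Real.norm_of_nonneg hm.le]
  rw [Real.mul_rpow hm.le (norm_nonneg _)]
  have : m ^ t = m ^ (t - 1) * m := by rw [← Real.rpow_add_one hm.ne', sub_add_cancel]
  rw [this]; push_cast; ring

theorem mazur_mazur {s t : ℝ} (ht : 0 < t) (v : ℂ) : mazur s (mazur t v) = mazur (s * t) v := by
  rcases eq_or_ne v 0 with rfl | hv
  · simp [mazur_zero]
  have h : 0 < ‖v‖ := norm_pos_iff.2 hv
  rw [mazur, norm_mazur ht, mazur, mazur, ← mul_assoc, ← Complex.ofReal_mul, ← Real.rpow_mul h.le,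
    ← Real.rpow_add h]
  ring_nf

theorem mazur_one (v : ℂ) : mazur 1 v = v := by simp [mazur]

theorem continuous_mazur {t : ℝ} (ht : 0 < t) : Continuous (mazur t) := by
  rw [continuous_iff_continuousAt]
  intro v
  rcases eq_or_ne v 0 with rfl | hv
  · rw [ContinuousAt, mazur_zero, tendsto_zero_iff_norm_tendsto_zero]
    simp_rw [norm_mazur ht]
    have : Continuous fun v : ℂ => ‖v‖ ^ t := continuous_norm.rpow_const fun _ => Or.inr ht.le
    simpa [Real.zero_rpow ht.ne'] using this.tendsto 0
  · have h : ContinuousAt (fun v : ℂ => ‖v‖ ^ (t - 1)) v :=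
      continuous_norm.continuousAt.rpow_const (Or.inl (norm_ne_zero_iff.2 hv))
    exact (Complex.continuous_ofReal.continuousAt.comp h).mul continuousAt_id

/-- Both sides are homogeneous of degree `t * r`, so it suffices to treat the unit disc. There,
close points are handled by uniform continuity on a compact set, and points at distance at least `δ`
by absorbing the trivial bound `2` into the term with `C`. This treats `t < 1` and `t > 1` alike. -/
theorem exists_norm_mazur_sub_le {t r : ℝ} (ht : 0 < t) (hr : 0 < r) {ε : ℝ} (hε : 0 < ε) :
    ∃ C : ℝ, 0 ≤ C ∧ ∀ a b : ℂ, ‖mazur t a - mazur t b‖ ^ r ≤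
      ε * (‖a‖ ^ (t * r) + ‖b‖ ^ (t * r)) + C * ‖a - b‖ ^ (t * r) := by
  have huc : UniformContinuousOn (mazur t) (Metric.closedBall 0 1) :=
    (isCompact_closedBall 0 1).uniformContinuousOn_of_continuous (continuous_mazur ht).continuousOn
  obtain ⟨δ, hδ, H⟩ := Metric.uniformContinuousOn_iff.1 huc (ε ^ r⁻¹) (by positivity)
  refine ⟨(2 / δ ^ t) ^ r, by positivity, ?_⟩
  have key : ∀ a b : ℂ, ‖a‖ ≤ 1 → ‖b‖ ≤ 1 → ‖mazur t a - mazur t b‖ ^ r ≤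
      ε + (2 / δ ^ t) ^ r * ‖a - b‖ ^ (t * r) := by
    intro a b ha hb
    by_cases hab : dist a b < δ
    · have h1 := H a (by simpa using ha) b (by simpa using hb) hab
      rw [dist_eq_norm] at h1
      have h2 : ‖mazur t a - mazur t b‖ ^ r ≤ (ε ^ r⁻¹) ^ r :=
        Real.rpow_le_rpow (norm_nonneg _) h1.le hr.le
      rw [Real.rpow_inv_rpow hε.le hr.ne'] at h2
      have : 0 ≤ (2 / δ ^ t) ^ r * ‖a - b‖ ^ (t * r) := by positivity
      linarith
    · rw [dist_eq_norm, not_lt] at hab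
      have h1 : ‖mazur t a - mazur t b‖ ≤ 2 := by
        refine (norm_sub_le _ _).trans ?_
        rw [norm_mazur ht, norm_mazur ht]
        have := Real.rpow_le_one (norm_nonneg a) ha ht.le
        have := Real.rpow_le_one (norm_nonneg b) hb ht.le
        linarith
      have h2 : (2 : ℝ) ≤ 2 / δ ^ t * ‖a - b‖ ^ t := by
        rw [div_mul_eq_mul_div, le_div_iff₀ (by positivity)]
        gcongr
      have h3 : ‖mazur t a - mazur t b‖ ^ r ≤ (2 / δ ^ t * ‖a - b‖ ^ t) ^ r :=
        Real.rpow_le_rpow (norm_nonneg _) (h1.trans h2) hr.le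
      rw [Real.mul_rpow (by positivity) (by positivity), ← Real.rpow_mul (norm_nonneg _)] at h3
      linarith
  intro a b
  -- Rescaling by the larger norm moves both points into the unit disc, and `m ^ (t * r)` is at most
  -- the sum of the two powers.
  set m := max ‖a‖ ‖b‖ with hm
  rcases (le_max_of_le_left (norm_nonneg a) : 0 ≤ m).eq_or_lt with h0 | h0
  · have ha : a = 0 := norm_le_zero_iff.1 (h0 ▸ le_max_left _ _)
    have hb : b = 0 := norm_le_zero_iff.1 (h0 ▸ le_max_right _ _)
    subst ha hb
    simp only [sub_self, norm_zero, Real.zero_rpow hr.ne']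
    positivity
  · have hm0 : (m : ℂ) ≠ 0 := by exact_mod_cast h0.ne'
    have e : ∀ v : ℂ, v = m * (v / m) := fun v => by field_simp
    have hn : ∀ v : ℂ, ‖v / m‖ = ‖v‖ / m := fun v => by
      rw [norm_div, Complex.norm_real, Real.norm_of_nonneg h0.le]
    have h1 := key (a / m) (b / m) (by rw [hn, div_le_one h0]; exact le_max_left _ _)
      (by rw [hn, div_le_one h0]; exact le_max_right _ _)
    have h2 : ‖mazur t a - mazur t b‖ ^ r =
        m ^ (t * r) * ‖mazur t (a / m) - mazur t (b / m)‖ ^ r := by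
      conv_lhs => rw [e a, e b]
      rw [mazur_real_mul h0, mazur_real_mul h0, ← mul_sub, norm_mul, Complex.norm_real,
        Real.norm_of_nonneg (by positivity), Real.mul_rpow (by positivity) (norm_nonneg _),
        ← Real.rpow_mul h0.le]
    have h3 : m ^ (t * r) * ‖a / m - b / m‖ ^ (t * r) = ‖a - b‖ ^ (t * r) := by
      rw [← sub_div, hn, ← Real.mul_rpow h0.le (by positivity)]
      congr 1; exact mul_div_cancel₀ _ h0.ne'
    have h4 : m ^ (t * r) ≤ ‖a‖ ^ (t * r) + ‖b‖ ^ (t * r) := by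
      have := Real.rpow_nonneg (norm_nonneg a) (t * r)
      have := Real.rpow_nonneg (norm_nonneg b) (t * r)
      rcases max_choice ‖a‖ ‖b‖ with h | h <;> rw [hm, h] <;> linarith
    rw [h2]
    calc _ ≤ m ^ (t * r) * (ε + (2 / δ ^ t) ^ r * ‖a / m - b / m‖ ^ (t * r)) := by gcongr
      _ = ε * m ^ (t * r) + (2 / δ ^ t) ^ r * (m ^ (t * r) * ‖a / m - b / m‖ ^ (t * r)) := by ring
      _ ≤ _ := by rw [h3]; gcongr

theorem energy_mazur {X : Type*} {t : ℝ} (ht : 0 < t) (r : ℝ) (f : X → ℂ) :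
    energy r (fun x => mazur t (f x)) = energy (t * r) f := by
  unfold energy
  congr 1; ext x
  rw [ENNReal.rpow_mul, ← ofReal_norm, norm_mazur ht, ← ofReal_norm,
    ENNReal.ofReal_rpow_of_nonneg (norm_nonneg _) ht.le]

/-- Uniform continuity of the Mazur map, in terms of energies. -/
theorem exists_energy_mazur_sub_le {t r : ℝ} (ht : 0 < t) (hr : 0 < r) {ε : ℝ≥0∞} (hε : ε ≠ 0) :
    ∃ C : ℝ≥0∞, C ≠ ⊤ ∧ ∀ {X : Type*} (f g : X → ℂ),
      energy r (fun x => mazur t (f x) - mazur t (g x)) ≤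
        ε * (energy (t * r) f + energy (t * r) g) + C * energy (t * r) (fun x => f x - g x) := by
  have htr : 0 < t * r := mul_pos ht hr
  obtain ⟨e, he, heε⟩ := exists_pos_ofReal_le hε
  obtain ⟨C, hC, H⟩ := exists_norm_mazur_sub_le ht hr he
  refine ⟨ENNReal.ofReal C, ENNReal.ofReal_ne_top, fun f g => ?_⟩
  unfold energy
  rw [← ENNReal.tsum_add, ← ENNReal.tsum_mul_left, ← ENNReal.tsum_mul_left, ← ENNReal.tsum_add]
  refine ENNReal.tsum_le_tsum fun x => ?_
  have h := ENNReal.ofReal_le_ofReal (H (f x) (g x))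
  rw [ENNReal.ofReal_add (by positivity) (by positivity), ENNReal.ofReal_mul he.le,
    ENNReal.ofReal_mul hC, ENNReal.ofReal_add (by positivity) (by positivity)] at h
  simp only [← ENNReal.ofReal_rpow_of_nonneg (norm_nonneg _) hr.le,
    ← ENNReal.ofReal_rpow_of_nonneg (norm_nonneg _) htr.le, ofReal_norm] at h
  exact h.trans (by gcongr)

end Mazur

theorem exists_lt_of_tsum_lt {ι : Type*} {a b : ι → ℝ≥0∞} (h : ∑' i, a i < ∑' i, b i) :
    ∃ i, a i < b i := by
  by_contra! hc
  exact absurd h (not_lt.2 (ENNReal.tsum_le_tsum hc))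

/-! ### Compact open subgroups and averaging -/

section CompactOpen

variable {G : Type*} [Group G] [TopologicalSpace G] [IsTopologicalGroup G]

/-- Van Dantzig's theorem. -/
theorem exists_openSubgroup_subset_of_mem_nhds [LocallyCompactSpace G] [TotallyDisconnectedSpace G]
    {V : Set G} (hV : V ∈ nhds (1 : G)) :
    ∃ U : OpenSubgroup G, IsCompact (U : Set G) ∧ (U : Set G) ⊆ V := by
  obtain ⟨K, hK, hKV, hKc⟩ := local_compact_nhds hV
  obtain ⟨W, hW, h1W, hWK⟩ := (loc_compact_Haus_tot_disc_of_zero_dim (H := G)).mem_nhds_iff.1 hK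
  have hWc : IsCompact W := hKc.of_isClosed_subset hW.isClosed hWK
  obtain ⟨T, hT, hTW⟩ := compact_open_separated_mul_right hWc hW.isOpen subset_rfl
  -- The right stabilizer of the compact open set `W`. It contains `T ∩ T⁻¹`, hence is open, and it
  -- lies in `W` because `1 ∈ W`.
  let S : Subgroup G :=
    { carrier := {g | ∀ w, w ∈ W ↔ w * g ∈ W}
      mul_mem' := fun {a b} ha hb w => by rw [ha w, hb (w * a), mul_assoc]
      one_mem' := fun w => by simp
      inv_mem' := fun {a} ha w => by rw [ha (w * a⁻¹), inv_mul_cancel_right] }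
  have hSo : IsOpen (S : Set G) := by
    refine S.isOpen_of_mem_nhds (g := 1) (Filter.mem_of_superset
      (Filter.inter_mem hT (inv_mem_nhds_one G hT)) fun g hg w => ⟨fun hw => ?_, fun hw => ?_⟩)
    · exact hTW (Set.mul_mem_mul hw hg.1)
    · simpa using hTW (Set.mul_mem_mul hw hg.2)
  have hSW : (S : Set G) ⊆ W := fun g hg => by simpa using (hg 1).1 h1W
  exact ⟨⟨S, hSo⟩, hWc.of_isClosed_subset (S.isClosed_of_isOpen hSo) hSW,
    hSW.trans (hWK.trans hKV)⟩

end CompactOpen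

section Averaging

variable {G : Type*} [Group G] {E : Type*} [NormedAddCommGroup E] [InnerProductSpace ℂ E]
  [CompleteSpace E]

theorem enorm_rpow_two {B : Type*} [NormedAddCommGroup B] (x : B) :
    ‖x‖ₑ ^ (2 : ℝ) = ENNReal.ofReal (‖x‖ ^ 2) := by
  rw [← ofReal_norm, ENNReal.ofReal_rpow_of_nonneg (norm_nonneg _) (by norm_num)]
  norm_num

/-- A vector moved by at most `δ` by a subgroup is within `δ` of a fixed vector. -/
theorem exists_fixed_near (π : G →* (E ≃ₗᵢ[ℂ] E)) (U : Subgroup G) (W : Submodule ℂ E)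
    (hWc : IsClosed (W : Set E)) (hW : ∀ g, ∀ f ∈ W, π g f ∈ W) {f : E} {δ : ℝ} (hf : f ∈ W)
    (h : ∀ u ∈ U, ‖π u f - f‖ ≤ δ) :
    ∃ f' ∈ W, (∀ u ∈ U, π u f' = f') ∧ ‖f' - f‖ ≤ δ := by
  let _ : InnerProductSpace ℝ E := InnerProductSpace.rclikeToReal ℂ E
  -- The vectors of `W` within `δ` of the whole `U`-orbit of `f`. This set is closed, convex and
  -- `U`-invariant, so its unique element of least norm is fixed by `U`; no integration over `U` is
  -- needed.
  let K : Set E := {v | v ∈ W ∧ ∀ u ∈ U, ‖v - π u f‖ ≤ δ}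
  have hKne : K.Nonempty := ⟨f, hf, fun u hu => by rw [norm_sub_rev]; exact h u hu⟩
  have hKc : IsClosed K := by
    have : K = (W : Set E) ∩ ⋂ u ∈ U, {v | ‖v - π u f‖ ≤ δ} := by ext v; simp [K]
    rw [this]
    refine hWc.inter (isClosed_biInter fun u _ => isClosed_le (by fun_prop) continuous_const)
  have hKv : Convex ℝ K := by
    have : K = (W.restrictScalars ℝ : Set E) ∩ ⋂ u ∈ U, Metric.closedBall (π u f) δ := by
      ext v; simp [K, dist_eq_norm]
    rw [this]
    exact (W.restrictScalars ℝ).convex.inter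
      (convex_iInter₂ fun u _ => convex_closedBall _ _)
  obtain ⟨v, hvK, hv⟩ := exists_norm_eq_iInf_of_complete_convex hKne hKc.isComplete hKv 0
  have hmin : ∀ w ∈ K, ‖v‖ ≤ ‖w‖ := fun w hw => by
    have h1 : ‖(0 : E) - v‖ ≤ ‖(0 : E) - w‖ := by
      rw [hv]
      exact ciInf_le ⟨0, by rintro _ ⟨x, rfl⟩; exact norm_nonneg _⟩ (⟨w, hw⟩ : K)
    simpa using h1
  have huniq : ∀ w ∈ K, ‖w‖ = ‖v‖ → w = v := fun w hw hwv => by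
    have hm : (1 / 2 : ℝ) • w + (1 / 2 : ℝ) • v ∈ K :=
      hKv hw hvK (by norm_num) (by norm_num) (by norm_num)
    have h1 := hmin _ hm
    rw [← smul_add, norm_smul] at h1
    norm_num at h1
    have h2 := parallelogram_law_with_norm ℝ w v
    rw [hwv] at h2
    have h3 : ‖w - v‖ = 0 := by
      nlinarith [norm_nonneg (w - v), norm_nonneg v, norm_nonneg (w + v)]
    exact sub_eq_zero.1 (norm_eq_zero.1 h3)
  refine ⟨v, hvK.1, fun u hu => huniq _ ⟨hW u v hvK.1, fun u' hu' => ?_⟩ ((π u).norm_map v), ?_⟩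
  · have h1 := hvK.2 (u⁻¹ * u') (U.mul_mem (U.inv_mem hu) hu')
    have h2 : π u' f = π u (π (u⁻¹ * u') f) := by
      conv_lhs => rw [← mul_inv_cancel_left u u', map_mul]
      rfl
    rwa [h2, ← map_sub, LinearIsometryEquiv.norm_map]
  · simpa using hvK.2 1 U.one_mem

/-- The nearby fixed vector has norm at least `c - δ` and, by the triangle inequality, is moved by
at most `3 * δ`. A small `δ` therefore makes the relative displacement as small as desired. -/
theorem exists_fixed_displacement_lt (π : G →* (E ≃ₗᵢ[ℂ] E)) (U : Subgroup G) (W : Submodule ℂ E)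
    (hWc : IsClosed (W : Set E)) (hW : ∀ g, ∀ f ∈ W, π g f ∈ W) (S : Finset G) {ε : ℝ≥0∞}
    (hε : ε ≠ 0) {c : ℝ} (hc : 0 < c) :
    ∃ δ > 0, ∀ f ∈ W, c ≤ ‖f‖ → (∀ u ∈ U, ‖π u f - f‖ ≤ δ) → (∀ s ∈ S, ‖π s f - f‖ ≤ δ) →
      ∃ f' ∈ W, (∀ u ∈ U, π u f' = f') ∧
        ∑ s ∈ S, ‖π s f' - f'‖ₑ ^ (2 : ℝ) < ε * ‖f'‖ₑ ^ (2 : ℝ) := by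
  obtain ⟨e, he, heε⟩ := exists_pos_ofReal_le hε
  have hev : ∀ᶠ δ in nhdsWithin (0 : ℝ) (Set.Ioi 0),
      (S.card : ℝ) * (3 * δ) ^ 2 < e * (c - δ) ^ 2 ∧ δ < c := by
    refine nhdsWithin_le_nhds (Filter.Eventually.and ?_ (eventually_lt_nhds hc))
    refine ContinuousAt.eventually_lt (by fun_prop) (by fun_prop) ?_
    simp; positivity
  obtain ⟨δ, ⟨h1, h2⟩, hδ⟩ := (hev.and self_mem_nhdsWithin).exists
  refine ⟨δ, hδ, fun f hf hcf hU hS => ?_⟩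
  obtain ⟨f', hf', hfix, hnear⟩ := exists_fixed_near π U W hWc hW hf hU
  refine ⟨f', hf', hfix, ?_⟩
  have hn : c - δ ≤ ‖f'‖ := by
    have := norm_sub_norm_le f f'
    rw [norm_sub_rev] at this
    linarith
  have hd : ∀ s ∈ S, ‖π s f' - f'‖ ≤ 3 * δ := fun s hs => by
    have h3 : π s f' - f' = π s (f' - f) + (π s f - f) + (f - f') := by
      rw [map_sub]; abel
    rw [h3]
    refine (norm_add₃_le).trans ?_
    rw [LinearIsometryEquiv.norm_map, norm_sub_rev f f']
    linarith [hS s hs]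
  simp_rw [enorm_rpow_two]
  refine lt_of_lt_of_le ?_ (mul_le_mul_left heε _)
  rw [← ENNReal.ofReal_sum_of_nonneg (fun _ _ => by positivity), ← ENNReal.ofReal_mul he.le]
  have hcd : 0 < c - δ := sub_pos.2 h2
  refine (ENNReal.ofReal_lt_ofReal_iff ?_).2 ?_
  · have : 0 < ‖f'‖ := hcd.trans_le hn
    positivity
  · calc ∑ s ∈ S, ‖π s f' - f'‖ ^ 2 ≤ ∑ s ∈ S, (3 * δ) ^ 2 :=
          Finset.sum_le_sum fun s hs => by gcongr; exact hd s hs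
      _ = S.card * (3 * δ) ^ 2 := by simp
      _ < e * (c - δ) ^ 2 := h1
      _ ≤ e * ‖f'‖ ^ 2 := by gcongr

end Averaging

/-! ### Almost invariant functions on coset spaces -/

section Cosets

variable {G : Type*} [Group G]

theorem hilbertSumRep_apply {ι : Type*} {E : ι → Type*} [∀ i, NormedAddCommGroup (E i)]
    [∀ i, NormedSpace ℂ (E i)] (π : ∀ i, G →* (E i ≃ₗᵢ[ℂ] E i)) (g : G) (f : lp E 2) (i : ι) :
    hilbertSumRep π g f i = π i g (f i) := rfl

theorem coe_complementRep_apply {E : Type*} [NormedAddCommGroup E] [InnerProductSpace ℂ E]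
    (π : G →* (E ≃ₗᵢ[ℂ] E)) (g : G) (f : (invariantVectors π)ᗮ) :
    (complementRep π g f : E) = π g f := rfl

theorem quasiRegularRep_apply {H : Subgroup G} (g : G) (f : lp (fun _ : G ⧸ H => ℂ) 2)
    (x : G ⧸ H) : quasiRegularRep H g f x = f (g⁻¹ • x) := rfl

theorem tsum_eq_zero_of_mem_orthogonal {H : Subgroup G} [Finite (G ⧸ H)]
    {f : lp (fun _ : G ⧸ H => ℂ) 2} (hf : f ∈ (invariantVectors (quasiRegularRep H))ᗮ) :
    ∑' x, f x = 0 := by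
  let u : lp (fun _ : G ⧸ H => ℂ) 2 := ⟨fun _ => 1, Memℓp.all _⟩
  have hu : u ∈ invariantVectors (quasiRegularRep H) := fun g => by
    ext x; rfl
  have h := (Submodule.mem_orthogonal _ _).1 hf u hu
  rw [lp.inner_eq_tsum] at h
  simpa [u] using h

/-- By transitivity invariant vectors are constant; on an infinite coset space square-summability
forces them to vanish, so a mean condition is needed only for finite index. -/
theorem mem_orthogonal_of_tsum_eq_zero {H : Subgroup G} {f : lp (fun _ : G ⧸ H => ℂ) 2}
    (hf : Finite (G ⧸ H) → ∑' x, f x = 0) : f ∈ (invariantVectors (quasiRegularRep H))ᗮ := by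
  refine (Submodule.mem_orthogonal _ _).2 fun u hu => ?_
  have hc : ∀ x, u x = u ((1 : G) : G ⧸ H) := fun x => by
    obtain ⟨g, rfl⟩ := QuotientGroup.mk_surjective x
    have := congrArg (fun v : lp (fun _ : G ⧸ H => ℂ) 2 => v (g : G ⧸ H)) (hu g)
    simp only [quasiRegularRep_apply] at this
    rw [← this]
    exact congrArg u (by rw [MulAction.Quotient.smul_coe, smul_eq_mul, inv_mul_cancel])
  rw [lp.inner_eq_tsum]
  by_cases hfin : Finite (G ⧸ H)
  · simp only [hc, RCLike.inner_apply, tsum_mul_right, hf hfin, zero_mul]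
  · rw [not_finite_iff_infinite] at hfin
    have hs := (lp.memℓp u).summable (by norm_num)
    simp only [hc] at hs
    rw [summable_const_iff] at hs
    have h0 : u ((1 : G) : G ⧸ H) = 0 := by
      rw [Real.rpow_eq_zero (norm_nonneg _) (by norm_num)] at hs
      exact norm_eq_zero.1 hs
    have h0' : ∀ x, u x = 0 := fun x => (hc x).trans h0
    simp [h0']

theorem tsum_enorm_two_eq {ι : Type*} {B : ι → Type*} [∀ i, NormedAddCommGroup (B i)]
    (f : lp B 2) : ‖f‖ₑ ^ (2 : ℝ) = ∑' i, ‖f i‖ₑ ^ (2 : ℝ) := by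
  simpa using lp.enorm_rpow_eq_tsum (p := 2) (by norm_num) f

theorem energy_two_eq {X : Type*} (f : lp (fun _ : X => ℂ) 2) :
    energy 2 f = ‖f‖ₑ ^ (2 : ℝ) := by
  simpa using lp.energy_eq (p := 2) (by norm_num) f

variable [TopologicalSpace G]

/-- There are `U`-invariant functions on the coset spaces `G ⧸ H`, `H` open, orthogonal to the
invariant functions in `ℓ²(G ⧸ H)` and moved relatively little by any given finite set. -/
def HasAlmostInvariantCosetFunctions (U : Subgroup G) : Prop :=
  ∀ (S : Finset G) (ε : ℝ≥0∞), ε ≠ 0 → ∃ (H : OpenSubgroup G) (f : G ⧸ (H : Subgroup G) → ℂ),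
    (∀ u ∈ U, ∀ x, f (u • x) = f x) ∧ energy 2 f ≠ ⊤ ∧
    (Finite (G ⧸ (H : Subgroup G)) → ∑' x, f x = 0) ∧
    ∑ s ∈ S, energy 2 (fun x => f (s⁻¹ • x) - f x) < ε * energy 2 f

/-- Squared norms add over the summands, so the strict inequality for a `U`-fixed vector of the
Hilbert sum must hold for one of its components. -/
theorem exists_summand_displacement_lt {ι : Type*} {E : ι → Type*} [∀ i, NormedAddCommGroup (E i)]
    [∀ i, InnerProductSpace ℂ (E i)] [∀ i, CompleteSpace (E i)] (π : ∀ i, G →* (E i ≃ₗᵢ[ℂ] E i))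
    (h : HasAlmostInvariantVectorsIn (hilbertSumRep π) ⊤) {U : Subgroup G}
    (hU : IsCompact (U : Set G)) (S : Finset G) {ε : ℝ≥0∞} (hε : ε ≠ 0) :
    ∃ i, ∃ v : E i, (∀ u ∈ U, π i u v = v) ∧
      ∑ s ∈ S, ‖π i s v - v‖ₑ ^ (2 : ℝ) < ε * ‖v‖ₑ ^ (2 : ℝ) := by
  obtain ⟨f, -, hf1, hfK⟩ := h
  obtain ⟨δ, hδ, H⟩ := exists_fixed_displacement_lt (hilbertSumRep π) U ⊤ isClosed_univ
    (fun _ _ _ => trivial) S hε one_pos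
  have hK := Metric.tendstoUniformlyOn_iff.1 (hfK (U ∪ S) (hU.union S.finite_toSet.isCompact)) δ hδ
  obtain ⟨n, hn⟩ := hK.exists
  obtain ⟨v, -, hvU, hv⟩ := H (f n) trivial (hf1 n).ge
    (fun u hu => by simpa using (hn u (Or.inl hu)).le)
    (fun s hs => by simpa using (hn s (Or.inr hs)).le)
  simp only [tsum_enorm_two_eq] at hv
  rw [← Summable.tsum_finsetSum (fun _ _ => ENNReal.summable), ← ENNReal.tsum_mul_left] at hv
  obtain ⟨i, hi⟩ := exists_lt_of_tsum_lt hv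
  refine ⟨i, v i, fun u hu => ?_, ?_⟩
  · conv_rhs => rw [← hvU u hu]
    rfl
  · simpa only [lp.coeFn_sub, Pi.sub_apply, hilbertSumRep_apply] using hi

theorem HasAlmostInvariantCosetFunctions.of_not_propertyTR {U : Subgroup G}
    (hU : IsCompact (U : Set G))
    (h : ¬ PropertyTR fun H : OpenSubgroup G => quasiRegularRep (H : Subgroup G)) :
    HasAlmostInvariantCosetFunctions U := by
  intro S ε hε
  obtain ⟨K, v, hvU, hv⟩ := exists_summand_displacement_lt _ (not_not.1 h) hU S hε
  refine ⟨K, (v : lp (fun _ : G ⧸ (K : Subgroup G) => ℂ) 2), fun u hu x => ?_, ?_,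
    fun _ => tsum_eq_zero_of_mem_orthogonal v.2, ?_⟩
  · have h1 := congrArg (fun w : (invariantVectors (quasiRegularRep (K : Subgroup G)))ᗮ =>
      (w : lp (fun _ : G ⧸ (K : Subgroup G) => ℂ) 2) x) (hvU _ (U.inv_mem hu))
    simp only [coe_complementRep_apply, quasiRegularRep_apply, inv_inv] at h1
    exact h1
  · rw [energy_two_eq]
    exact ENNReal.rpow_ne_top_of_nonneg (by norm_num) enorm_ne_top
  · rw [energy_two_eq]
    refine lt_of_eq_of_lt (Finset.sum_congr rfl fun s _ => ?_) hv
    exact energy_two_eq (quasiRegularRep (K : Subgroup G) s v -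
      (v : lp (fun _ : G ⧸ (K : Subgroup G) => ℂ) 2))

end Cosets

/-! ### From finite sets to compact sets: normalized sequences -/

section Sequence

variable {G : Type*} [Group G] [TopologicalSpace G]

theorem energy_const_mul {X : Type*} {r : ℝ} (hr : 0 ≤ r) (c : ℂ) (f : X → ℂ) :
    energy r (fun x => c * f x) = ‖c‖ₑ ^ r * energy r f := by
  unfold energy
  rw [← ENNReal.tsum_mul_left]
  congr 1; ext x
  rw [enorm_mul, ENNReal.mul_rpow_of_nonneg _ _ hr]

theorem exists_const_mul_energy_eq_one {X : Type*} {f : X → ℂ} {r : ℝ} (hr : 0 < r)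
    (h0 : energy r f ≠ 0) (ht : energy r f ≠ ⊤) :
    ∃ c : ℂ, ‖c‖ₑ ^ r = (energy r f)⁻¹ := by
  refine ⟨(((energy r f).toReal ^ r⁻¹)⁻¹ : ℝ), ?_⟩
  have hpos : 0 < (energy r f).toReal := ENNReal.toReal_pos h0 ht
  rw [← ofReal_norm, Complex.norm_real, Real.norm_of_nonneg (by positivity),
    ENNReal.ofReal_rpow_of_nonneg (by positivity) hr.le, Real.inv_rpow (by positivity),
    Real.rpow_inv_rpow hpos.le hr.ne', ENNReal.ofReal_inv_of_pos hpos, ENNReal.ofReal_toReal ht]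

/-- A compact set meets only finitely many cosets of an open subgroup. -/
theorem exists_seq_coset_reps [IsTopologicalGroup G] [SecondCountableTopology G]
    {U : Subgroup G} (hU : IsOpen (U : Set G)) :
    ∃ s : ℕ → G, ∀ K : Set G, IsCompact K → ∃ N : ℕ, ∀ g ∈ K, ∃ k ≤ N, (s k)⁻¹ * g ∈ U := by
  have : DiscreteTopology (G ⧸ U) := QuotientGroup.discreteTopology hU
  have : Countable (G ⧸ U) := TopologicalSpace.separableSpace_iff_countable.1 inferInstance
  obtain ⟨d, hd⟩ := exists_surjective_nat (G ⧸ U)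
  refine ⟨fun n => (d n).out, fun K hK => ?_⟩
  have hfin : ((QuotientGroup.mk : G → G ⧸ U) '' K).Finite :=
    (hK.image QuotientGroup.continuous_mk).finite_of_discrete
  choose k hk using hd
  obtain ⟨N, hN⟩ := (hfin.image k).bddAbove
  refine ⟨N, fun g hg => ⟨k g, hN ⟨_, ⟨g, hg, rfl⟩, rfl⟩, ?_⟩⟩
  rw [← QuotientGroup.eq, QuotientGroup.out_eq', hk]

/-- A `U`-invariant function is displaced by `g` exactly as by the chosen representative of the
coset of `g`, so uniform control on a compact set is control on finitely many representatives. -/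
theorem HasAlmostInvariantCosetFunctions.exists_seq [IsTopologicalGroup G]
    [SecondCountableTopology G] {U : Subgroup G} (hU : IsOpen (U : Set G))
    (h : HasAlmostInvariantCosetFunctions U) :
    ∃ (H : ℕ → OpenSubgroup G) (f : ∀ n, G ⧸ (H n : Subgroup G) → ℂ),
      (∀ n, energy 2 (f n) = 1) ∧
      (∀ n, Finite (G ⧸ (H n : Subgroup G)) → ∑' x, f n x = 0) ∧
      ∀ K : Set G, IsCompact K → ∀ ε : ℝ≥0∞, ε ≠ 0 → ∀ᶠ n in Filter.atTop, ∀ g ∈ K,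
        energy 2 (fun x => f n (g⁻¹ • x) - f n x) ≤ ε := by
  classical
  obtain ⟨s, hs⟩ := exists_seq_coset_reps hU
  -- The `n`-th function is almost invariant under the first `n + 1` representatives, with tolerance
  -- `1 / n`. At `n = 0` the tolerance is `⊤`, which is harmless; the strict inequality still forces
  -- nonzero energy.
  choose H f hfU hft hf0 hf using fun n : ℕ =>
    h ((Finset.range (n + 1)).image s) ((n : ℝ≥0∞)⁻¹) (by simp)
  have hne : ∀ n, energy 2 (f n) ≠ 0 := fun n h0 => by simpa [h0] using hf n
  choose c hc using fun n => exists_const_mul_energy_eq_one two_pos (hne n) (hft n)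
  refine ⟨H, fun n x => c n * f n x, fun n => ?_, fun n hn => ?_, fun K hK ε hε => ?_⟩
  · rw [energy_const_mul two_pos.le, hc, ENNReal.inv_mul_cancel (hne n) (hft n)]
  · rw [tsum_mul_left, hf0 n hn, mul_zero]
  · obtain ⟨N, hN⟩ := hs K hK
    have hlim : ∀ᶠ n : ℕ in Filter.atTop, ((n : ℝ≥0∞)⁻¹) < ε :=
      ENNReal.tendsto_inv_nat_nhds_zero.eventually_lt_const (pos_iff_ne_zero.2 hε)
    filter_upwards [hlim, Filter.eventually_ge_atTop N] with n hn hnN g hg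
    obtain ⟨k, hkN, hk⟩ := hN g hg
    have h1 : ∀ x, f n (g⁻¹ • x) = f n ((s k)⁻¹ • x) := fun x => by
      rw [← hfU n _ hk, smul_smul, mul_inv_cancel_right]
    simp_rw [h1, ← mul_sub]
    rw [energy_const_mul two_pos.le (c n) fun x => f n ((s k)⁻¹ • x) - f n x, hc]
    have h2 : energy 2 (fun x => f n ((s k)⁻¹ • x) - f n x) ≤ (n : ℝ≥0∞)⁻¹ * energy 2 (f n) :=
      (Finset.single_le_sum (f := fun s => energy 2 (fun x => f n (s⁻¹ • x) - f n x))
        (fun _ _ => zero_le) (Finset.mem_image_of_mem s (Finset.mem_range.2 (by omega)))).trans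
        (hf n).le
    calc _ ≤ (energy 2 (f n))⁻¹ * ((n : ℝ≥0∞)⁻¹ * energy 2 (f n)) := by gcongr
      _ = (n : ℝ≥0∞)⁻¹ * ((energy 2 (f n))⁻¹ * energy 2 (f n)) := by ring
      _ = (n : ℝ≥0∞)⁻¹ := by rw [ENNReal.inv_mul_cancel (hne n) (hft n), mul_one]
      _ ≤ ε := hn.le

theorem norm_lt_of_enorm_rpow_lt {B : Type*} [NormedAddCommGroup B] {x : B} {r e : ℝ} (hr : 0 < r)
    (he : 0 < e) (h : ‖x‖ₑ ^ r < ENNReal.ofReal (e ^ r)) : ‖x‖ < e := by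
  rw [← ENNReal.ofReal_rpow_of_nonneg he.le hr.le, ENNReal.rpow_lt_rpow_iff hr, ← ofReal_norm,
    ENNReal.ofReal_lt_ofReal_iff he] at h
  exact h

theorem norm_eq_one_of_enorm_rpow_eq_one {B : Type*} [NormedAddCommGroup B] {x : B} {r : ℝ}
    (hr : 0 < r) (h : ‖x‖ₑ ^ r = 1) : ‖x‖ = 1 := by
  have h1 : ‖x‖ₑ = 1 := by
    have := congrArg (· ^ r⁻¹) h
    simpa [ENNReal.rpow_rpow_inv hr.ne'] using this
  rw [← toReal_enorm, h1, ENNReal.toReal_one]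

/-- A criterion for almost invariant vectors in terms of powers of norms. -/
theorem hasAlmostInvariantVectorsIn_of_enorm {B : Type*} [NormedAddCommGroup B] [NormedSpace ℂ B]
    (π : G →* (B ≃ₗᵢ[ℂ] B)) (W : Submodule ℂ B) {r : ℝ} (hr : 0 < r) (f : ℕ → B)
    (hW : ∀ n, f n ∈ W) (h1 : ∀ n, ‖f n‖ₑ ^ r = 1)
    (h : ∀ K : Set G, IsCompact K → ∀ ε : ℝ≥0∞, ε ≠ 0 → ∀ᶠ n in Filter.atTop, ∀ g ∈ K,
      ‖π g (f n) - f n‖ₑ ^ r ≤ ε) :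
    HasAlmostInvariantVectorsIn π W := by
  refine ⟨f, hW, fun n => norm_eq_one_of_enorm_rpow_eq_one hr (h1 n), fun K hK => ?_⟩
  refine Metric.tendstoUniformlyOn_iff.2 fun e he => ?_
  have h0 : ENNReal.ofReal (e ^ r) ≠ 0 := (ENNReal.ofReal_pos.2 (by positivity)).ne'
  obtain ⟨ε, hε, hεe⟩ := exists_between (pos_iff_ne_zero.2 h0)
  filter_upwards [h K hK ε hε.ne'] with n hn g hg
  simpa using norm_lt_of_enorm_rpow_lt hr he ((hn g hg).trans_lt hεe)

theorem hasAlmostInvariantVectorsIn_hilbertSumRep {ι : Type*} {E : ι → Type*}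
    [∀ i, NormedAddCommGroup (E i)] [∀ i, NormedSpace ℂ (E i)] (π : ∀ i, G →* (E i ≃ₗᵢ[ℂ] E i))
    (i : ℕ → ι) (v : ∀ n, E (i n)) (h1 : ∀ n, ‖v n‖ₑ ^ (2 : ℝ) = 1)
    (h : ∀ K : Set G, IsCompact K → ∀ ε : ℝ≥0∞, ε ≠ 0 → ∀ᶠ n in Filter.atTop, ∀ g ∈ K,
      ‖π (i n) g (v n) - v n‖ₑ ^ (2 : ℝ) ≤ ε) :
    HasAlmostInvariantVectorsIn (hilbertSumRep π) ⊤ := by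
  classical
  have hs : ∀ n (w : E (i n)), ‖lp.single 2 (i n) w‖ₑ = ‖w‖ₑ := fun n w => by
    rw [← ofReal_norm, lp.norm_single (by norm_num), ofReal_norm]
  refine hasAlmostInvariantVectorsIn_of_enorm _ _ two_pos (fun n => lp.single 2 (i n) (v n))
    (fun _ => trivial) (fun n => by rw [hs, h1]) fun K hK ε hε => ?_
  filter_upwards [h K hK ε hε] with n hn g hg
  have : hilbertSumRep π g (lp.single 2 (i n) (v n)) - lp.single 2 (i n) (v n) =
      lp.single 2 (i n) (π (i n) g (v n) - v n) := by
    rw [lp.single_sub]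
    congr 1
    ext j
    rw [hilbertSumRep_apply]
    rcases eq_or_ne j (i n) with rfl | hj
    · simp
    · simp [hj]
  rw [this, hs]
  exact hn g hg

theorem HasAlmostInvariantCosetFunctions.not_propertyTR [IsTopologicalGroup G]
    [SecondCountableTopology G] {U : Subgroup G} (hU : IsOpen (U : Set G))
    (h : HasAlmostInvariantCosetFunctions U) :
    ¬ PropertyTR fun H : OpenSubgroup G => quasiRegularRep (H : Subgroup G) := by
  obtain ⟨H, f, hf1, hf0, hf⟩ := h.exists_seq hU
  rw [PropertyTR, not_not]
  let F : ∀ n, lp (fun _ : G ⧸ (H n : Subgroup G) => ℂ) 2 := fun n =>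
    ⟨f n, (memℓp_iff_energy_ne_top (by norm_num) _).2 (by simp [hf1])⟩
  refine hasAlmostInvariantVectorsIn_hilbertSumRep _ H
    (fun n => ⟨F n, mem_orthogonal_of_tsum_eq_zero (hf0 n)⟩) (fun n => ?_) fun K hK ε hε => ?_
  · exact (energy_two_eq (F n)).symm.trans (hf1 n)
  · filter_upwards [hf K hK ε hε] with n hn g hg
    exact (energy_two_eq (quasiRegularRep (H n : Subgroup G) g (F n) - F n)).symm.trans_le (hn g hg)

end Sequence

/-! ### Restriction to a single orbit -/

section Transfer

variable {G : Type*} [Group G] [TopologicalSpace G]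

/-- Functions on `G`-sets with open stabilizers give functions on coset spaces. -/
theorem exists_coset_function {Y : Type*} [MulAction G Y]
    (hst : ∀ y : Y, IsOpen (MulAction.stabilizer G y : Set G)) (U : Subgroup G) (S : Finset G)
    (ε : ℝ≥0∞) (F : Y → ℂ) (hU : ∀ u ∈ U, ∀ y, F (u • y) = F y) (hF : energy 2 F ≠ ⊤)
    (h0 : ∀ y : Y, (MulAction.orbit G y).Finite → ∑' x : MulAction.orbit G y, F x = 0)
    (hlt : ∑ s ∈ S, energy 2 (fun y => F (s⁻¹ • y) - F y) < ε * energy 2 F) :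
    ∃ (H : OpenSubgroup G) (f : G ⧸ (H : Subgroup G) → ℂ),
      (∀ u ∈ U, ∀ x, f (u • x) = f x) ∧ energy 2 f ≠ ⊤ ∧
      (Finite (G ⧸ (H : Subgroup G)) → ∑' x, f x = 0) ∧
      ∑ s ∈ S, energy 2 (fun x => f (s⁻¹ • x) - f x) < ε * energy 2 f := by
  unfold energy at hlt
  rw [← Summable.tsum_finsetSum (fun _ _ => ENNReal.summable), ← ENNReal.tsum_mul_left] at hlt
  -- Energies are sums over orbits, so the inequality already holds on one orbit, which is then
  -- identified with the quotient by an open stabilizer.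
  obtain ⟨c, hc⟩ := exists_fiber_tsum_lt (fun y => MulAction.orbit G y) hlt
  have hne : ((fun y => MulAction.orbit G y) ⁻¹' {c}).Nonempty := by
    by_contra hn
    rw [Set.not_nonempty_iff_eq_empty] at hn
    rw [hn] at hc
    simp at hc
  obtain ⟨y, rfl⟩ := hne
  have hfib : (fun y' => MulAction.orbit G y') ⁻¹' {MulAction.orbit G y} = MulAction.orbit G y := by
    ext y'; simp [MulAction.orbit_eq_iff]
  rw [hfib] at hc
  let e : G ⧸ MulAction.stabilizer G y ≃ MulAction.orbit G y :=
    (MulAction.orbitEquivQuotientStabilizer G y).symm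
  have he : ∀ (g : G) x, ((e (g • x) : MulAction.orbit G y) : Y) = g • (e x : Y) := fun g x => by
    obtain ⟨k, rfl⟩ := QuotientGroup.mk_surjective x
    simp only [e, MulAction.Quotient.smul_coe, smul_eq_mul,
      MulAction.orbitEquivQuotientStabilizer_symm_apply, mul_smul]
  refine ⟨⟨MulAction.stabilizer G y, hst y⟩, fun x => F (e x), fun u hu x => ?_, ?_, fun hfin => ?_,
    ?_⟩
  · exact (congrArg F (he u x)).trans (hU u hu _)
  · have h1 : energy 2 (fun x => F (e x)) = energy 2 (fun y' : MulAction.orbit G y => F y') :=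
      energy_comp_equiv 2 e (fun y' : MulAction.orbit G y => F y')
    refine ne_top_of_le_ne_top hF (h1.trans_le ?_)
    exact ENNReal.tsum_comp_le_tsum_of_injective Subtype.val_injective fun x => ‖F x‖ₑ ^ (2 : ℝ)
  · have hfin' : Finite (MulAction.orbit G y) := e.finite_iff.1 hfin
    rw [← h0 y (Set.toFinite _)]
    exact e.tsum_eq fun x => F x
  · unfold energy
    rw [← Summable.tsum_finsetSum (fun _ _ => ENNReal.summable), ← ENNReal.tsum_mul_left]
    rw [← e.tsum_eq, ← e.tsum_eq (fun y' : MulAction.orbit G y => ε * ‖F y'‖ₑ ^ (2 : ℝ))] at hc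
    refine lt_of_eq_of_lt ?_ hc
    refine tsum_congr fun x => Finset.sum_congr rfl fun s _ => ?_
    exact congrArg (fun w => ‖F w - F (e x)‖ₑ ^ (2 : ℝ)) (he s⁻¹ x)

end Transfer

/-! ### Monomial representations -/

/-- An action of `G` on `X × Circle` commuting with the translations of the second factor. Such
actions describe the representations of `G` on `ℓ_p(X)` by monomial isometries. -/
structure MonomialAction (G X : Type*) [Group G] where
  /-- The underlying action. -/
  toHom : G →* Equiv.Perm (X × Circle)
  map_mul_right : ∀ g x z w, toHom g (x, z * w) = ((toHom g (x, z)).1, (toHom g (x, z)).2 * w)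

/-- The function on `X × Circle`, homogeneous in the second variable, attached to a function
on `X`. -/
noncomputable def twist {X : Type*} (f : X → ℂ) (y : X × Circle) : ℂ := (y.2⁻¹ : Circle) * f y.1

namespace MonomialAction

variable {G X : Type*} [Group G] (ρ : MonomialAction G X)

theorem map_eq (g : G) (x : X) (z : Circle) :
    ρ.toHom g (x, z) = ((ρ.toHom g (x, 1)).1, (ρ.toHom g (x, 1)).2 * z) := by
  simpa using ρ.map_mul_right g x 1 z

theorem map_inv_map (g : G) (y : X × Circle) : ρ.toHom g⁻¹ (ρ.toHom g y) = y := by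
  rw [map_inv]; exact (ρ.toHom g).symm_apply_apply y

theorem map_map_inv (g : G) (y : X × Circle) : ρ.toHom g (ρ.toHom g⁻¹ y) = y := by
  rw [map_inv]; exact (ρ.toHom g).apply_symm_apply y

theorem map_mul_apply (g h : G) (y : X × Circle) :
    ρ.toHom (g * h) y = ρ.toHom g (ρ.toHom h y) := by
  rw [map_mul]; rfl

/-- The induced action on the base. -/
noncomputable def base : G →* Equiv.Perm X where
  toFun g :=
    { toFun := fun x => (ρ.toHom g (x, 1)).1
      invFun := fun x => (ρ.toHom g⁻¹ (x, 1)).1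
      left_inv := fun x => by
        have h := ρ.map_inv_map g (x, 1)
        rw [ρ.map_eq g⁻¹ (ρ.toHom g (x, 1)).1] at h
        exact congrArg Prod.fst h
      right_inv := fun x => by
        have h := ρ.map_map_inv g (x, 1)
        rw [ρ.map_eq g (ρ.toHom g⁻¹ (x, 1)).1] at h
        exact congrArg Prod.fst h }
  map_one' := by ext x; simp
  map_mul' g h := by
    ext x
    have := ρ.map_mul_apply g h (x, 1)
    rw [ρ.map_eq g (ρ.toHom h (x, 1)).1] at this
    change (ρ.toHom (g * h) (x, 1)).1 = (ρ.toHom g ((ρ.toHom h (x, 1)).1, 1)).1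
    rw [this]

theorem fst_map (g : G) (y : X × Circle) : (ρ.toHom g y).1 = ρ.base g y.1 := by
  rw [ρ.map_eq g y.1]; rfl

/-- The monomial action of `G` on functions on `X`. -/
noncomputable def act (g : G) (f : X → ℂ) (x : X) : ℂ := twist f (ρ.toHom g⁻¹ (x, 1))

/-- The factor `z⁻¹` in `twist` is chosen so that the monomial action becomes plain translation of
functions on `X × Circle`. -/
theorem twist_act (g : G) (f : X → ℂ) (y : X × Circle) :
    twist (ρ.act g f) y = twist f (ρ.toHom g⁻¹ y) := by
  rw [ρ.map_eq g⁻¹ y.1]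
  simp only [twist, act, mul_inv, Circle.coe_mul]
  ring

theorem act_one (f : X → ℂ) : ρ.act 1 f = f := by
  ext x; simp [act, twist]

theorem act_mul (g h : G) (f : X → ℂ) : ρ.act (g * h) f = ρ.act g (ρ.act h f) := by
  ext x
  rw [act, act, twist_act, mul_inv_rev, map_mul_apply]

theorem act_add (g : G) (f f' : X → ℂ) : ρ.act g (f + f') = ρ.act g f + ρ.act g f' := by
  ext x; simp [act, twist, mul_add]

theorem act_smul (g : G) (c : ℂ) (f : X → ℂ) : ρ.act g (c • f) = c • ρ.act g f := by
  ext x; simp [act, twist, mul_left_comm]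

theorem norm_act (g : G) (f : X → ℂ) (x : X) : ‖ρ.act g f x‖ = ‖f (ρ.base g⁻¹ x)‖ := by
  rw [act, twist, norm_mul, Circle.norm_coe, one_mul, fst_map]

theorem energy_act (r : ℝ) (g : G) (f : X → ℂ) : energy r (ρ.act g f) = energy r f := by
  rw [← energy_comp_equiv r (ρ.base g⁻¹) f]
  exact energy_congr_norm (ρ.norm_act g f)

theorem act_mazur (t : ℝ) (g : G) (f : X → ℂ) (x : X) :
    ρ.act g (fun x => mazur t (f x)) x = mazur t (ρ.act g f x) := by
  simp only [act, twist, mazur_circle_mul]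

variable (p : ℝ≥0∞) [Fact (1 ≤ p)] (hp : 0 < p.toReal)

/-- The monomial representation on `ℓ_p(X)`. -/
noncomputable def rep (hp : 0 < p.toReal) :
    G →* (lp (fun _ : X => ℂ) p ≃ₗᵢ[ℂ] lp (fun _ : X => ℂ) p) :=
  have key : ∀ (g : G) (f : lp (fun _ : X => ℂ) p), Memℓp (ρ.act g f) p := fun g f =>
    (memℓp_iff_energy_ne_top hp _).2 (by
      rw [energy_act]; exact (memℓp_iff_energy_ne_top hp _).1 (lp.memℓp f))
  { toFun := fun g =>
      { toFun := fun f => ⟨ρ.act g f, key g f⟩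
        invFun := fun f => ⟨ρ.act g⁻¹ f, key g⁻¹ f⟩
        map_add' := fun f f' => Subtype.ext (ρ.act_add g f f')
        map_smul' := fun c f => Subtype.ext (ρ.act_smul g c f)
        left_inv := fun f => Subtype.ext (by
          change ρ.act g⁻¹ (ρ.act g f) = f
          rw [← act_mul, inv_mul_cancel, act_one])
        right_inv := fun f => Subtype.ext (by
          change ρ.act g (ρ.act g⁻¹ f) = f
          rw [← act_mul, mul_inv_cancel, act_one])
        norm_map' := fun f => by
          have h := ρ.energy_act p.toReal g f
          have h1 := lp.energy_eq hp (⟨ρ.act g f, key g f⟩ : lp (fun _ : X => ℂ) p)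
          have h2 : energy p.toReal (ρ.act g f) =
            ‖(⟨ρ.act g f, key g f⟩ : lp (fun _ : X => ℂ) p)‖ₑ ^ p.toReal := h1
          rw [h, lp.energy_eq hp] at h2
          have h3 := congrArg (fun x => (x ^ (p.toReal)⁻¹).toReal) h2
          simp only [ENNReal.rpow_rpow_inv hp.ne', toReal_enorm] at h3
          exact h3.symm }
    map_one' := by
      ext f x
      exact congrFun (ρ.act_one f) x
    map_mul' := fun g h => by
      ext f x
      exact congrFun (ρ.act_mul g h f) x }

theorem coe_rep_apply (g : G) (f : lp (fun _ : X => ℂ) p) :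
    ⇑(ρ.rep p hp g f) = ρ.act g f := rfl

theorem rep_single [DecidableEq X] (g : G) (y : X × Circle) :
    ρ.rep p hp g (lp.single p y.1 (y.2 : ℂ)) =
      lp.single p (ρ.toHom g y).1 ((ρ.toHom g y).2 : ℂ) := by
  ext x
  rw [coe_rep_apply, act, twist]
  set w := ρ.toHom g⁻¹ (x, 1) with hw
  have hx : ρ.toHom g w = (x, 1) := ρ.map_map_inv g _
  by_cases h : w.1 = y.1
  · have hy : ρ.toHom g y = (x, w.2⁻¹ * y.2) := by
      have : y = (w.1, w.2 * (w.2⁻¹ * y.2)) := by rw [h, mul_inv_cancel_left]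
      rw [this, map_mul_right, Prod.mk.eta, hx]
      simp
    rw [hy, h, lp.single_apply_self, lp.single_apply_self, Circle.coe_mul]
  · have h' : x ≠ (ρ.toHom g y).1 := fun h' => h <| by
      have h1 := congrArg Prod.fst hx
      rw [fst_map] at h1 h'
      exact (ρ.base g).injective (h1.trans h')
    rw [lp.single_apply_ne _ _ _ h, lp.single_apply_ne _ _ _ h', mul_zero]

/-- Open stabilizers make the orbit maps of basis vectors locally constant. Since the operators are
isometries, the orbit map of a general vector is a uniform limit of those of its finite truncations.
-/
theorem isStronglyContinuous_rep [TopologicalSpace G] [ContinuousMul G] (hpt : p ≠ ⊤)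
    (hst : ∀ x : X, IsOpen {g | ρ.toHom g (x, 1) = (x, 1)}) :
    IsStronglyContinuous (ρ.rep p hp) := by
  classical
  have hs : ∀ x (a : ℂ), Continuous fun g => ρ.rep p hp g (lp.single p x a) := fun x a => by
    have h1 : (lp.single p x a : lp (fun _ : X => ℂ) p) = a • lp.single p x (1 : ℂ) := by
      rw [← lp.single_smul, smul_eq_mul, mul_one]
    simp_rw [h1, map_smul]
    refine Continuous.const_smul (continuous_iff_continuousAt.2 fun g₀ => ?_) a
    have hn : ∀ᶠ g in nhds g₀, g₀⁻¹ * g ∈ {g | ρ.toHom g (x, 1) = (x, 1)} := by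
      refine (continuous_const_mul g₀⁻¹).continuousAt.eventually_mem ((hst x).mem_nhds ?_)
      simp
    refine ContinuousAt.congr (f := fun _ => ρ.rep p hp g₀ (lp.single p x (1 : ℂ)))
      continuousAt_const ?_
    filter_upwards [hn] with g hg
    have h2 := ρ.rep_single p hp (g₀⁻¹ * g) (x, 1)
    rw [hg] at h2
    simp only [Circle.coe_one] at h2
    conv_rhs => rw [← mul_inv_cancel_left g₀ g, map_mul]
    conv_lhs => rw [← h2]
    rfl
  intro f
  have hf := lp.hasSum_single hpt f
  refine TendstoUniformly.continuous (p := Filter.atTop)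
    (F := fun (s : Finset X) g => ρ.rep p hp g (∑ i ∈ s, lp.single p i (f i))) ?_
    (Filter.Frequently.of_forall fun s => ?_)
  · rw [Metric.tendstoUniformly_iff]
    intro ε hε
    filter_upwards [Metric.tendsto_nhds.1 hf ε hε] with s hs' g
    rw [(ρ.rep p hp g).dist_map, dist_comm]
    exact hs'
  · simp_rw [map_sum]
    exact continuous_finsetSum _ fun i _ => hs i _

end MonomialAction

/-! ### From coset functions to permutation representations on `ℓ_p` -/

section Extend

variable {X Z : Type*} {j : Z → X}

theorem energy_extend (hj : Function.Injective j) {r : ℝ} (hr : 0 < r) (h : Z → ℂ) :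
    energy r (Function.extend j h 0) = energy r h := by
  unfold energy
  have hsupp : Function.support (fun x => ‖Function.extend j h 0 x‖ₑ ^ r) ⊆ Set.range j := by
    intro x hx
    by_contra hx'
    exact hx (by simp [Function.extend_apply' _ _ _ hx', hr])
  rw [← hj.tsum_eq hsupp]
  simp [hj.extend_apply]

theorem extend_sub (hj : Function.Injective j) (h h' : Z → ℂ) (x : X) :
    Function.extend j h 0 x - Function.extend j h' 0 x =
      Function.extend j (fun z => h z - h' z) 0 x := by
  by_cases hx : ∃ z, j z = x
  · obtain ⟨z, rfl⟩ := hx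
    simp [hj.extend_apply]
  · simp [Function.extend_apply' _ _ _ hx]

end Extend

/-! ### Mazur images and constants -/

section Mean

variable {Z : Type*}

/-- Subtracting a constant from a function of mean zero increases the `2`-energy. -/
theorem energy_two_le_sub_const [Finite Z] {f : Z → ℂ} (hf : ∑' z, f z = 0) (d : ℂ) :
    energy 2 f ≤ energy 2 (fun z => f z - d) := by
  have := Fintype.ofFinite Z
  unfold energy
  rw [tsum_fintype] at hf
  rw [tsum_fintype, tsum_fintype]
  simp_rw [enorm_rpow_two]
  rw [← ENNReal.ofReal_sum_of_nonneg (fun _ _ => by positivity),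
    ← ENNReal.ofReal_sum_of_nonneg (fun _ _ => by positivity)]
  refine ENNReal.ofReal_le_ofReal ?_
  have h : ∀ z, ‖f z - d‖ ^ 2 = ‖f z‖ ^ 2 - 2 * (f z * (starRingEnd ℂ) d).re + ‖d‖ ^ 2 := fun z => by
    rw [← Complex.normSq_eq_norm_sq, ← Complex.normSq_eq_norm_sq, ← Complex.normSq_eq_norm_sq,
      Complex.normSq_sub]
    ring
  simp_rw [h, Finset.sum_add_distrib, Finset.sum_sub_distrib, ← Finset.mul_sum, ← Complex.re_sum,
    ← Finset.sum_mul, hf]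
  simp
  positivity

/-- The Mazur image of a unit vector orthogonal to the constants is uniformly far from the
constants. -/
theorem exists_energy_mazur_sub_const_ge {r : ℝ} (hr : 1 ≤ r) :
    ∃ κ : ℝ≥0∞, κ ≠ 0 ∧ ∀ {Z : Type*} (f : Z → ℂ) (c : ℂ), energy 2 f = 1 →
      (Finite Z → ∑' z, f z = 0) → (Infinite Z → c = 0) →
      κ ≤ energy r (fun z => mazur (2 / r) (f z) - c) := by
  have hr0 : 0 < r := by linarith
  set A : ℝ≥0∞ := 2 ^ (r - 1) with hA
  have hAt : A ≠ ⊤ := ENNReal.rpow_ne_top_of_nonneg (by linarith) (by simp)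
  -- Applying the inverse Mazur map to `g` and `c` gives `1 ≤ ε * (1 + energy r c) + C * E`, while
  -- `energy r c ≤ A * (1 + E)`. The choice of `ε` makes `ε * (1 + A) = 1/2`, leaving `1/2 ≤ (ε * A
  -- + C) * E`.
  obtain ⟨C, hC, H⟩ := exists_energy_mazur_sub_le (t := r / 2) (r := 2) (by positivity) two_pos
    (ε := (2 * (1 + A))⁻¹) (ENNReal.inv_ne_zero.2 (by finiteness))
  set ε : ℝ≥0∞ := (2 * (1 + A))⁻¹ with hε
  have hεt : ε ≠ ⊤ := ENNReal.inv_ne_top.2 (by simp)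
  refine ⟨(2 * (ε * A + C))⁻¹, ENNReal.inv_ne_zero.2 (by finiteness), fun {Z} f c hf h0 hc => ?_⟩
  have e1 : r / 2 * 2 = r := by ring
  have e2 : r / 2 * (2 / r) = 1 := by field_simp
  have e3 : 2 / r * r = 2 := by field_simp
  set g : Z → ℂ := fun z => mazur (2 / r) (f z)
  set E := energy r (fun z => g z - c) with hE
  have hg : energy r g = 1 := by
    have := energy_mazur (t := 2 / r) (by positivity) r f
    rw [e3, hf] at this
    exact this
  have hcE : energy r (fun _ : Z => c) ≤ A * (1 + E) := by
    have := energy_sub_le hr g (fun z => g z - c)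
    simp only [sub_sub_cancel] at this
    rwa [hg] at this
  have h1 : 1 ≤ energy 2 (fun z => mazur (r / 2) (g z) - mazur (r / 2) c) := by
    simp only [g, mazur_mazur (div_pos two_pos hr0), e2, mazur_one]
    rw [← hf]
    rcases finite_or_infinite Z with hZ | hZ
    · exact energy_two_le_sub_const (h0 hZ) _
    · simp [hc hZ, mazur_zero]
  have h2 := H g (fun _ => c)
  rw [e1, hg] at h2
  have h3 : (1 : ℝ≥0∞) ≤ ε * (1 + A) + (ε * A + C) * E := by
    calc (1 : ℝ≥0∞) ≤ _ := h1.trans h2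
      _ ≤ ε * (1 + A * (1 + E)) + C * E := by gcongr
      _ = _ := by ring
  have h4 : ε * (1 + A) = 2⁻¹ := by
    rw [hε, ENNReal.mul_inv (by simp) (by simp), mul_assoc,
      ENNReal.inv_mul_cancel (by simp) (by finiteness), mul_one]
  rw [h4, ← ENNReal.inv_two_add_inv_two, ENNReal.add_le_add_iff_left (by simp)] at h3
  rw [ENNReal.mul_inv (by simp) (by simp)]
  exact ENNReal.div_le_of_le_mul' h3

end Mean

/-! ### Permutation representations on `ℓ_p` -/

section Perm

variable {G X : Type*} [Group G]

/-- A permutation action as a monomial action. -/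
noncomputable def MonomialAction.ofPerm (σ : G →* Equiv.Perm X) : MonomialAction G X where
  toHom :=
    { toFun := fun g => Equiv.prodCongr (σ g) (Equiv.refl Circle)
      map_one' := by ext <;> simp
      map_mul' := fun g h => by ext <;> simp }
  map_mul_right _ _ _ _ := rfl

theorem MonomialAction.ofPerm_toHom_apply (σ : G →* Equiv.Perm X) (g : G) (y : X × Circle) :
    (ofPerm σ).toHom g y = (σ g y.1, y.2) := rfl

theorem MonomialAction.act_ofPerm (σ : G →* Equiv.Perm X) (g : G) (f : X → ℂ) (x : X) :
    (ofPerm σ).act g f x = f (σ g⁻¹ x) := by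
  rw [act, ofPerm_toHom_apply]; simp [twist]

theorem MonomialAction.act_ofPerm_extend {Z : Type*} [MulAction G Z] {j : Z → X}
    (hj : Function.Injective j) (σ : G →* Equiv.Perm X) (hσ : ∀ g z, σ g (j z) = j (g • z))
    (g : G) (h : Z → ℂ) :
    (ofPerm σ).act g (Function.extend j h 0) = Function.extend j (fun z => h (g⁻¹ • z)) 0 := by
  ext x
  rw [act_ofPerm]
  by_cases hx : ∃ z, j z = x
  · obtain ⟨z, rfl⟩ := hx
    rw [hσ, hj.extend_apply, hj.extend_apply]
  · rw [Function.extend_apply' _ _ _ hx, Function.extend_apply']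
    · rfl
    · rintro ⟨z, hz⟩
      refine hx ⟨g • z, ?_⟩
      rw [← hσ, hz, map_inv]
      exact (σ g).apply_symm_apply x

variable {p : ℝ≥0∞} [Fact (1 ≤ p)]

/-- A functional on `ℓ_p`, `p > 1`, cannot be constant and nonzero on infinitely many basis
vectors. -/
theorem eq_zero_of_forall_single_eq [DecidableEq X] (hp1 : 1 < p.toReal)
    (φ : StrongDual ℂ (lp (fun _ : X => ℂ) p))
    {T : Set X} (hT : T.Infinite) {d : ℂ} (h : ∀ x ∈ T, φ (lp.single p x 1) = d) : d = 0 := by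
  have hp : 0 < p.toReal := by linarith
  by_contra hd
  have hd' : 0 < ‖d‖ := norm_pos_iff.2 hd
  -- Testing on a sum of `N` basis vectors gives `N * ‖d‖ ≤ ‖φ‖ * N ^ (1 / p)`; since `p > 1` this
  -- fails for large `N`.
  have key : ∀ N : ℕ, 0 < N → (N : ℝ) ^ (p.toReal - 1) ≤ ‖φ‖ ^ p.toReal / ‖d‖ ^ p.toReal := by
    intro N hN
    obtain ⟨s, hsT, hs⟩ := hT.exists_subset_card_eq N
    have h1 := φ.le_opNorm (∑ x ∈ s, lp.single p x (1 : ℂ))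
    rw [map_sum, Finset.sum_congr rfl fun x hx => h x (hsT hx), Finset.sum_const, hs,
      nsmul_eq_mul, norm_mul, Complex.norm_natCast] at h1
    have h2 := lp.norm_sum_single hp (fun _ : X => (1 : ℂ)) s
    simp only [norm_one, Real.one_rpow, Finset.sum_const, hs, nsmul_eq_mul, mul_one] at h2
    have h3 := Real.rpow_le_rpow (by positivity) h1 hp.le
    rw [Real.mul_rpow (by positivity) (by positivity), Real.mul_rpow (by positivity) (by positivity),
      h2] at h3
    have hN' : (0 : ℝ) < N := by exact_mod_cast hN
    rw [le_div_iff₀ (by positivity), Real.rpow_sub_one hN'.ne']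
    rw [div_mul_eq_mul_div, div_le_iff₀ hN']
    exact h3
  have ht : Filter.Tendsto (fun N : ℕ => (N : ℝ) ^ (p.toReal - 1)) Filter.atTop Filter.atTop :=
    (tendsto_rpow_atTop (by linarith)).comp tendsto_natCast_atTop_atTop
  obtain ⟨N, hN, hN0⟩ := ((ht.eventually_gt_atTop (‖φ‖ ^ p.toReal / ‖d‖ ^ p.toReal)).and
    (Filter.eventually_gt_atTop 0)).exists
  exact absurd (key N hN0) (not_le.2 hN)

/-- An invariant functional takes one value `d` on all basis vectors of the orbit `j(Z)`, so it
sends `v` to `d * ∑ h`. The sum vanishes if `Z` is finite, and `d` vanishes if `Z` is infinite. -/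
theorem extend_mem_dualInvariantsAnnihilator {Z : Type*} [MulAction G Z] [MulAction.IsPretransitive G Z]
    {j : Z → X} (hj : Function.Injective j) (σ : G →* Equiv.Perm X)
    (hσ : ∀ g z, σ g (j z) = j (g • z)) (hp1 : 1 < p.toReal) (hpt : p ≠ ⊤) (hp : 0 < p.toReal)
    (h : Z → ℂ) (h0 : Finite Z → ∑' z, h z = 0) (v : lp (fun _ : X => ℂ) p)
    (hv : ⇑v = Function.extend j h 0) :
    v ∈ dualInvariantsAnnihilator ((MonomialAction.ofPerm σ).rep p hp) := by
  classical
  intro φ hφ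
  rcases isEmpty_or_nonempty Z with hZ | ⟨⟨z₀⟩⟩
  · have : v = 0 := by
      ext x
      rw [hv, Function.extend_apply' _ _ _ (by rintro ⟨z, -⟩; exact hZ.elim z)]
      rfl
    rw [this, map_zero]
  have hd : ∀ z, φ (lp.single p (j z) 1) = φ (lp.single p (j z₀) 1) := fun z => by
    obtain ⟨g, rfl⟩ := MulAction.exists_smul_eq G z₀ z
    have h1 := (MonomialAction.ofPerm σ).rep_single p hp g (j z₀, 1)
    rw [MonomialAction.ofPerm_toHom_apply, hσ] at h1
    simp only [Circle.coe_one] at h1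
    have h2 := congrArg (fun ψ : StrongDual ℂ (lp (fun _ : X => ℂ) p) =>
      ψ (lp.single p (j (g • z₀)) 1)) (hφ g)
    rw [← h2, ← h1]
    change φ (((MonomialAction.ofPerm σ).rep p hp g).symm
      ((MonomialAction.ofPerm σ).rep p hp g _)) = _
    rw [LinearIsometryEquiv.symm_apply_apply]
  have hsum := φ.hasSum (lp.hasSum_single hpt v)
  have hterm : ∀ x, φ (lp.single p x (v x)) = v x * φ (lp.single p x 1) := fun x => by
    rw [← smul_eq_mul, ← map_smul, ← lp.single_smul, smul_eq_mul, mul_one]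
  have h1 : φ v = ∑' x, v x * φ (lp.single p x 1) := by
    rw [← hsum.tsum_eq]; exact tsum_congr hterm
  have hsupp : Function.support (fun x => v x * φ (lp.single p x 1)) ⊆ Set.range j := by
    intro x hx
    by_contra hx'
    exact hx (by simp only [hv, Function.extend_apply' _ _ _ hx']; simp)
  rw [h1, ← hj.tsum_eq hsupp]
  simp only [hv, hj.extend_apply, hd]
  rw [tsum_mul_right]
  rcases finite_or_infinite Z with hZ | hZ
  · rw [h0 hZ, zero_mul]
  · rw [eq_zero_of_forall_single_eq hp1 φ (T := Set.range j) (Set.infinite_range_of_injective hj)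
      (d := φ (lp.single p (j z₀) 1)) (by rintro _ ⟨z, rfl⟩; exact hd z), mul_zero]

end Perm

section PermRep

variable {G : Type*} [Group G] [TopologicalSpace G]

theorem exists_mean {r : ℝ} {Z : Type*} (g : Z → ℂ) (hg : energy r g ≠ ⊤) (hr : 1 ≤ r) :
    ∃ c : ℂ, (Infinite Z → c = 0) ∧ (Finite Z → ∑' z, (g z - c) = 0) ∧
      energy r (fun z => g z - c) ≠ ⊤ := by
  rcases finite_or_infinite Z with hZ | hZ
  · have := Fintype.ofFinite Z
    refine ⟨(∑ z, g z) / Fintype.card Z, fun h => absurd hZ (not_finite_iff_infinite.2 h),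
      fun _ => ?_, ?_⟩
    · rw [tsum_fintype, Finset.sum_sub_distrib, Finset.sum_const, Finset.card_univ, nsmul_eq_mul]
      rcases isEmpty_or_nonempty Z with h | h
      · simp
      · rw [mul_div_cancel₀ _ (by simp), sub_self]
    · unfold energy
      rw [tsum_fintype]
      refine (ENNReal.sum_lt_top.2 fun z _ => ?_).ne
      exact (ENNReal.rpow_ne_top_of_nonneg (by linarith) enorm_ne_top).lt_top
  · exact ⟨0, fun _ => rfl, fun h => absurd h (not_finite_iff_infinite.2 hZ), by simpa using hg⟩

/-- The vectors are Mazur images of the coset functions, corrected to mean zero on finite coset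
spaces, renormalized, and placed on the disjoint union of the coset spaces. The lower bound `κ`
keeps the renormalization from magnifying displacements without control. -/
theorem HasAlmostInvariantCosetFunctions.not_propertyTlp [IsTopologicalGroup G]
    [SecondCountableTopology G] {U : Subgroup G} (hU : IsOpen (U : Set G))
    (h : HasAlmostInvariantCosetFunctions U) {p : ℝ≥0∞} [Fact (1 ≤ p)] (hp1 : 1 < p)
    (hpt : p < ⊤) : ¬ PropertyTlp G p := by
  obtain ⟨H, f, hf1, hf0, hf⟩ := h.exists_seq hU
  have hr1 : 1 < p.toReal := by
    rw [← ENNReal.toReal_one]; exact ENNReal.toReal_strict_mono hpt.ne hp1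
  have hr : 0 < p.toReal := by linarith
  set r := p.toReal with hrdef
  have hcount : ∀ n, Countable (G ⧸ (H n : Subgroup G)) := fun n =>
    TopologicalSpace.separableSpace_iff_countable.1 inferInstance
  -- The union is infinite even if every coset space is finite, because the index `n` ranges over
  -- `ℕ`; hence it can be identified with `ℕ`.
  have hinf : Infinite (Σ n, G ⧸ (H n : Subgroup G)) :=
    Infinite.of_injective (fun n => ⟨n, (1 : G)⟩) fun a b hab => congrArg Sigma.fst hab
  obtain ⟨_⟩ := nonempty_denumerable (Σ n, G ⧸ (H n : Subgroup G))
  let e : (Σ n, G ⧸ (H n : Subgroup G)) ≃ ℕ := Denumerable.eqv _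
  let σ : G →* Equiv.Perm ℕ :=
    e.permCongrHom.toMonoidHom.comp (MulAction.toPermHom G _)
  have hσe : ∀ g x, σ g (e x) = e (g • x) := fun g x => by simp [σ, Equiv.permCongrHom]
  let j : ∀ n, G ⧸ (H n : Subgroup G) → ℕ := fun n x => e ⟨n, x⟩
  have hj : ∀ n, Function.Injective (j n) := fun n => e.injective.comp sigma_mk_injective
  have hσ : ∀ n g x, σ g (j n x) = j n (g • x) := fun n g x => hσe g ⟨n, x⟩
  let ρ := MonomialAction.ofPerm σ
  have hst : ∀ k : ℕ, IsOpen {g | ρ.toHom g (k, 1) = (k, 1)} := fun k => by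
    obtain ⟨⟨n, x⟩, rfl⟩ := e.surjective k
    obtain ⟨a, rfl⟩ := QuotientGroup.mk_surjective x
    have : {g | ρ.toHom g (e ⟨n, (a : G ⧸ (H n : Subgroup G))⟩, 1) = (e ⟨n, a⟩, 1)} =
        (fun g => a⁻¹ * g * a) ⁻¹' (H n : Set G) := by
      ext g
      simp only [ρ, MonomialAction.ofPerm_toHom_apply, hσe, Set.mem_ofPred_eq, Prod.mk.injEq,
        EmbeddingLike.apply_eq_iff_eq, and_true, Sigma.smul_mk, Set.mem_preimage, Sigma.mk.injEq,
        true_and, heq_eq_eq, MulAction.Quotient.smul_coe, smul_eq_mul, SetLike.mem_coe]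
      rw [eq_comm, QuotientGroup.eq, mul_assoc]
      rfl
    rw [this]
    exact (H n).isOpen.preimage (by fun_prop)
  obtain ⟨κ, hκ, hκE⟩ := exists_energy_mazur_sub_const_ge hr1.le
  have hmaz : ∀ n, energy r (fun z => mazur (2 / r) (f n z)) = 1 := fun n => by
    rw [energy_mazur (by positivity), div_mul_cancel₀ _ hr.ne', hf1]
  choose c hcinf hcfin hct using fun n =>
    exists_mean (fun z => mazur (2 / r) (f n z)) (by rw [hmaz]; simp) hr1.le
  have hκn : ∀ n, κ ≤ energy r (fun z => mazur (2 / r) (f n z) - c n) := fun n =>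
    hκE (f n) (c n) (hf1 n) (hf0 n) (hcinf n)
  choose b hb using fun n => exists_const_mul_energy_eq_one hr
    (ne_of_gt ((pos_iff_ne_zero.2 hκ).trans_le (hκn n))) (hct n)
  let k : ∀ n, G ⧸ (H n : Subgroup G) → ℂ := fun n z => b n * (mazur (2 / r) (f n z) - c n)
  have hk1 : ∀ n, energy r (k n) = 1 := fun n => by
    simp only [k]
    rw [energy_const_mul hr.le, hb, ENNReal.inv_mul_cancel _ (hct n)]
    exact ne_of_gt ((pos_iff_ne_zero.2 hκ).trans_le (hκn n))
  let v : ℕ → lp (fun _ : ℕ => ℂ) p := fun n => ⟨Function.extend (j n) (k n) 0,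
    (memℓp_iff_energy_ne_top hr _).2 (by rw [energy_extend (hj n) hr, hk1]; simp)⟩
  intro hT
  refine hT (ρ.rep p hr) (ρ.isStronglyContinuous_rep p hr hpt.ne hst)
    (hasAlmostInvariantVectorsIn_of_enorm _ _ hr v (fun n => ?_) (fun n => ?_) fun K hK ε hε => ?_)
  · refine extend_mem_dualInvariantsAnnihilator (hj n) σ (hσ n) hr1 hpt.ne hr (k n) (fun hfin => ?_)
      (v n) rfl
    simp only [k]
    rw [tsum_mul_left, hcfin n hfin, mul_zero]
  · rw [← lp.energy_eq hr]
    exact (energy_extend (hj n) hr _).trans (hk1 n)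
  · have hκt : κ ≠ ⊤ := ne_top_of_le_ne_top (hct 0) (hκn 0)
    -- The two error terms are each at most `ε * κ / 2`, and normalization costs a factor at most
    -- `κ⁻¹`. Dividing by `C + 1` instead of `C` allows for `C = 0`.
    obtain ⟨C, hC, hM⟩ := exists_energy_mazur_sub_le (t := 2 / r) (by positivity) hr
      (ε := ε * κ / 4) (by simp [hε, hκ])
    have hη : ε * κ / 2 / (C + 1) ≠ 0 := by simp [hε, hκ, hC]
    filter_upwards [hf K hK _ hη] with n hn g hg
    have h1 : energy r (fun z => k n (g⁻¹ • z) - k n z) ≤ ε := by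
      have h2 : ∀ z, k n (g⁻¹ • z) - k n z =
          b n * (mazur (2 / r) (f n (g⁻¹ • z)) - mazur (2 / r) (f n z)) := fun z => by
        simp only [k]; ring
      simp_rw [h2]
      rw [energy_const_mul hr.le, hb]
      have h3 := hM (fun z => f n (g⁻¹ • z)) (f n)
      have h4 : energy 2 (fun z => f n (g⁻¹ • z)) = 1 := (energy_comp_equiv 2
        (MulAction.toPerm g⁻¹ : Equiv.Perm (G ⧸ (H n : Subgroup G))) (f n)).trans (hf1 n)
      rw [div_mul_cancel₀ _ hr.ne', hf1, h4] at h3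
      calc _ ≤ κ⁻¹ * (ε * κ / 4 * (1 + 1) + C * (ε * κ / 2 / (C + 1))) := by
            gcongr
            · exact hκn n
            · exact h3.trans (by gcongr; exact hn g hg)
        _ ≤ κ⁻¹ * (ε * κ / 2 + ε * κ / 2) := by
            gcongr
            · rw [ENNReal.div_eq_inv_mul, ENNReal.div_eq_inv_mul, mul_right_comm]
              gcongr
              rw [one_add_one_eq_two, show (4 : ℝ≥0∞) = 2 * 2 by norm_num,
                ENNReal.mul_inv (by simp) (by simp), mul_assoc,
                ENNReal.inv_mul_cancel (by simp) (by simp), mul_one]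
            · calc C * (ε * κ / 2 / (C + 1)) ≤ (C + 1) * (ε * κ / 2 / (C + 1)) := by
                    gcongr; exact le_self_add
                _ ≤ _ := ENNReal.mul_div_le
        _ = ε := by
            rw [ENNReal.add_halves, mul_comm ε, ← mul_assoc, ENNReal.inv_mul_cancel hκ hκt, one_mul]
    rw [← lp.energy_eq hr]
    refine le_of_eq_of_le ?_ h1
    rw [← energy_extend (hj n) hr]
    congr 1
    ext x
    rw [lp.coeFn_sub, Pi.sub_apply, MonomialAction.coe_rep_apply]
    rw [← extend_sub (hj n), ← MonomialAction.act_ofPerm_extend (hj n) σ (hσ n)]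

end PermRep

/-! ### Isometries of `ℓ_p`, `p ≠ 2` -/

section Clarkson

theorem add_rpow_lt_rpow_add {a b s : ℝ} (ha : 0 < a) (hb : 0 < b) (hs : 1 < s) :
    a ^ s + b ^ s < (a + b) ^ s := by
  have h : ∀ {x : ℝ}, 0 < x → x ^ s = x * x ^ (s - 1) := fun {x} hx => by
    rw [mul_comm, ← Real.rpow_add_one hx.ne', sub_add_cancel]
  rw [h ha, h hb, h (add_pos ha hb), add_mul]
  have h1 : a ^ (s - 1) < (a + b) ^ (s - 1) :=
    Real.rpow_lt_rpow ha.le (by linarith) (by linarith)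
  have h2 : b ^ (s - 1) < (a + b) ^ (s - 1) :=
    Real.rpow_lt_rpow hb.le (by linarith) (by linarith)
  nlinarith

theorem rpow_add_lt_add_rpow {a b s : ℝ} (ha : 0 < a) (hb : 0 < b) (hs : s < 1) :
    (a + b) ^ s < a ^ s + b ^ s := by
  have h : ∀ {x : ℝ}, 0 < x → x ^ s = x * x ^ (s - 1) := fun {x} hx => by
    rw [mul_comm, ← Real.rpow_add_one hx.ne', sub_add_cancel]
  rw [h ha, h hb, h (add_pos ha hb), add_mul]
  have h1 : (a + b) ^ (s - 1) < a ^ (s - 1) :=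
    Real.rpow_lt_rpow_of_neg ha (by linarith) (by linarith)
  have h2 : (a + b) ^ (s - 1) < b ^ (s - 1) :=
    Real.rpow_lt_rpow_of_neg hb (by linarith) (by linarith)
  nlinarith

/-- The defect in the parallelogram identity with exponent `r`. -/
noncomputable def parallelogramDefect (r : ℝ) (a b : ℂ) : ℝ :=
  ‖a + b‖ ^ r + ‖a - b‖ ^ r - 2 * (‖a‖ ^ r + ‖b‖ ^ r)

theorem norm_rpow_eq_sq_rpow (r : ℝ) (a : ℂ) : ‖a‖ ^ r = (‖a‖ ^ 2) ^ (r / 2) := by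
  rw [← Real.rpow_natCast, ← Real.rpow_mul (norm_nonneg _)]
  congr 1; push_cast; ring

theorem sq_norm_add_eq (a b : ℂ) :
    (1 / 2 : ℝ) * ‖a + b‖ ^ 2 + (1 / 2) * ‖a - b‖ ^ 2 = ‖a‖ ^ 2 + ‖b‖ ^ 2 := by
  have := parallelogram_law_with_norm ℝ a b
  nlinarith

theorem parallelogramDefect_eq_zero {r : ℝ} (hr : 0 < r) {a b : ℂ} (h : a = 0 ∨ b = 0) :
    parallelogramDefect r a b = 0 := by
  rcases h with rfl | rfl <;> simp [parallelogramDefect, Real.zero_rpow hr.ne'] <;> ring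

/-- With `s = r / 2 > 1`, convexity of `x ↦ x ^ s` and the parallelogram law bound the first two
terms below by `2 * (‖a‖² + ‖b‖²) ^ s`; strict superadditivity of the power does the rest. For `r <
2` all inequalities reverse. -/
theorem parallelogramDefect_pos {r : ℝ} (hr : 2 < r) {a b : ℂ} (ha : a ≠ 0) (hb : b ≠ 0) :
    0 < parallelogramDefect r a b := by
  have h1 := add_rpow_lt_rpow_add (a := ‖a‖ ^ 2) (b := ‖b‖ ^ 2) (s := r / 2) (by positivity)
    (by positivity) (by linarith)
  have h2 := (convexOn_rpow (p := r / 2) (by linarith)).2 (Set.mem_Ici.2 (sq_nonneg ‖a + b‖))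
    (Set.mem_Ici.2 (sq_nonneg ‖a - b‖)) one_half_pos.le one_half_pos.le (add_halves (1 : ℝ))
  simp only [smul_eq_mul] at h2
  rw [sq_norm_add_eq] at h2
  simp only [parallelogramDefect, norm_rpow_eq_sq_rpow r]
  linarith

theorem parallelogramDefect_neg {r : ℝ} (hr0 : 0 < r) (hr : r < 2) {a b : ℂ} (ha : a ≠ 0)
    (hb : b ≠ 0) : parallelogramDefect r a b < 0 := by
  have h1 := rpow_add_lt_add_rpow (a := ‖a‖ ^ 2) (b := ‖b‖ ^ 2) (s := r / 2) (by positivity)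
    (by positivity) (by linarith)
  have h2 := (Real.concaveOn_rpow (p := r / 2) (by linarith) (by linarith)).2
    (Set.mem_Ici.2 (sq_nonneg ‖a + b‖)) (Set.mem_Ici.2 (sq_nonneg ‖a - b‖)) one_half_pos.le
    one_half_pos.le (add_halves (1 : ℝ))
  simp only [smul_eq_mul] at h2
  rw [sq_norm_add_eq] at h2
  simp only [parallelogramDefect, norm_rpow_eq_sq_rpow r]
  linarith

/-- All terms have the same sign, so a zero sum forces each to vanish, which happens only where one
of the functions is zero. -/
theorem eq_zero_or_of_hasSum_parallelogramDefect {X : Type*} {r : ℝ} (hr0 : 0 < r) (hr : r ≠ 2)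
    {u w : X → ℂ} (h : HasSum (fun x => parallelogramDefect r (u x) (w x)) 0) (x : X) :
    u x = 0 ∨ w x = 0 := by
  by_contra! hx
  rcases lt_or_gt_of_ne hr with h2 | h2
  · have hle : ∀ y, parallelogramDefect r (u y) (w y) ≤ 0 := fun y => by
      by_cases hy : u y = 0 ∨ w y = 0
      · exact (parallelogramDefect_eq_zero hr0 hy).le
      · push Not at hy
        exact (parallelogramDefect_neg hr0 h2 hy.1 hy.2).le
    have h3 := (hasSum_zero_iff_of_nonneg fun y => neg_nonneg.2 (hle y)).1 (by simpa using h.neg)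
    have h4 := congrFun h3 x
    have h5 := parallelogramDefect_neg hr0 h2 hx.1 hx.2
    simp only [Pi.zero_apply] at h4
    linarith
  · have hle : ∀ y, 0 ≤ parallelogramDefect r (u y) (w y) := fun y => by
      by_cases hy : u y = 0 ∨ w y = 0
      · exact (parallelogramDefect_eq_zero hr0 hy).ge
      · push Not at hy
        exact (parallelogramDefect_pos h2 hy.1 hy.2).le
    have h3 := (hasSum_zero_iff_of_nonneg hle).1 h
    have h4 := congrFun h3 x
    have h5 := parallelogramDefect_pos h2 hx.1 hx.2
    simp only [Pi.zero_apply] at h4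
    linarith

end Clarkson

section Lamperti

variable {X : Type*} [DecidableEq X] {p : ℝ≥0∞}

theorem norm_single_add_single_rpow (hp : 0 < p.toReal) {i j : X} (hij : i ≠ j) {c : ℂ}
    (hc : ‖c‖ = 1) :
    ‖(lp.single p i 1 + lp.single p j c : lp (fun _ : X => ℂ) p)‖ ^ p.toReal = 2 := by
  have h := lp.norm_sum_single hp (fun x : X => if x = i then (1 : ℂ) else c) {i, j}
  rw [Finset.sum_pair hij, Finset.sum_pair hij] at h
  simp only [if_true, if_neg hij.symm, norm_one, hc, Real.one_rpow] at h
  rw [h]; norm_num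

variable [Fact (1 ≤ p)]

/-- Isometries of `ℓ_p`, `p ≠ 2`, map distinct basis vectors to disjointly supported vectors. -/
theorem isometry_single_disjoint (hp : 0 < p.toReal) (hp2 : p.toReal ≠ 2)
    (T : lp (fun _ : X => ℂ) p ≃ₗᵢ[ℂ] lp (fun _ : X => ℂ) p) {i j : X} (hij : i ≠ j) (x : X) :
    T (lp.single p i 1) x = 0 ∨ T (lp.single p j 1) x = 0 := by
  refine eq_zero_or_of_hasSum_parallelogramDefect hp hp2 (u := T (lp.single p i 1))
    (w := T (lp.single p j 1)) ?_ x
  have h1 := lp.hasSum_norm hp (T (lp.single p i 1) + T (lp.single p j 1))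
  have h2 := lp.hasSum_norm hp (T (lp.single p i 1) - T (lp.single p j 1))
  have h3 := lp.hasSum_norm hp (T (lp.single p i 1))
  have h4 := lp.hasSum_norm hp (T (lp.single p j 1))
  have e1 : ∀ k : X, ‖(lp.single p k 1 : lp (fun _ : X => ℂ) p)‖ = 1 := fun k => by
    rw [lp.norm_single (by exact lt_of_lt_of_le one_pos Fact.out), norm_one]
  rw [← map_add, T.norm_map, norm_single_add_single_rpow hp hij norm_one] at h1
  rw [← map_sub, T.norm_map, sub_eq_add_neg, ← lp.single_neg,
    norm_single_add_single_rpow hp hij (by simp)] at h2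
  rw [T.norm_map, e1, Real.one_rpow] at h3 h4
  -- The total defect of two distinct basis vectors is `2 + 2 - 2 * (1 + 1) = 0`, and `T` preserves
  -- the four norms involved.
  have h5 := (h1.add h2).sub ((h3.add h4).mul_left 2)
  norm_num at h5
  convert! h5 using 2

/-- Isometries of `ℓ_p`, `p ≠ 2`, permute the unimodular multiples of the basis vectors. -/
theorem exists_isometry_single_eq (hp : 0 < p.toReal) (hpt : p ≠ ⊤) (hp2 : p.toReal ≠ 2)
    (T : lp (fun _ : X => ℂ) p ≃ₗᵢ[ℂ] lp (fun _ : X => ℂ) p) (x : X) :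
    ∃ (y : X) (z : Circle), T (lp.single p x 1) = lp.single p y (z : ℂ) := by
  have hp0 : 0 < p := lt_of_lt_of_le one_pos Fact.out
  -- By disjointness of supports, only the `x`-coordinate of `h` contributes to `T h` at a point of
  -- the support of `T e_x`. Taking `h` with `T h = e_y` shows that this support is the single point
  -- `y`.
  have key : ∀ (h : lp (fun _ : X => ℂ) p) (y : X), T (lp.single p x 1) y ≠ 0 →
      T h y = h x * T (lp.single p x 1) y := fun h y hy => by
    have h1 := ((lp.evalCLM ℂ (fun _ : X => ℂ) p y).comp
      (T.toContinuousLinearEquiv : lp (fun _ : X => ℂ) p →L[ℂ] _)).hasSum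
      (lp.hasSum_single hpt h)
    have h2 : ∀ i, (lp.single p i (h i) : lp (fun _ : X => ℂ) p) = h i • lp.single p i 1 :=
      fun i => by rw [← lp.single_smul, smul_eq_mul, mul_one]
    have h3 : HasSum (fun i => h i * T (lp.single p i 1) y) (T h y) := by
      simp only [h2, map_smul] at h1
      exact h1
    refine h3.unique (hasSum_single x fun i hi => ?_)
    rw [(isometry_single_disjoint hp hp2 T hi y).resolve_right hy, mul_zero]
  have hne : T (lp.single p x 1) ≠ 0 := fun h => by
    have := T.norm_map (lp.single p x 1)
    rw [h, norm_zero, lp.norm_single hp0, norm_one] at this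
    exact zero_ne_one this
  obtain ⟨y, hy⟩ : ∃ y, T (lp.single p x 1) y ≠ 0 := by
    by_contra! hc
    exact hne (by ext y; exact hc y)
  obtain ⟨h, hh⟩ := T.surjective (lp.single p y 1)
  have h1 : h x ≠ 0 := fun h0 => by
    have := key h y hy
    rw [hh, lp.single_apply_self, h0, zero_mul] at this
    exact one_ne_zero this
  have h2 : T (lp.single p x 1) = lp.single p y (T (lp.single p x 1) y) := by
    ext y'
    rcases eq_or_ne y' y with rfl | hyy
    · rw [lp.single_apply_self]
    · rw [lp.single_apply_ne _ _ _ hyy]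
      by_contra hc
      have := key h y' hc
      rw [hh, lp.single_apply_ne _ _ _ hyy] at this
      exact mul_ne_zero h1 hc this.symm
  have h3 : ‖T (lp.single p x 1) y‖ = 1 := by
    have h4 := T.norm_map (lp.single p x 1)
    rw [h2, lp.norm_single hp0, lp.norm_single hp0, norm_one] at h4
    exact h4
  exact ⟨y, ⟨_, mem_sphere_zero_iff_norm.2 h3⟩, h2⟩

theorem single_circle_injective (p : ℝ≥0∞) :
    Function.Injective fun y : X × Circle =>
      (lp.single p y.1 (y.2 : ℂ) : lp (fun _ : X => ℂ) p) := by
  intro y y' h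
  have h1 := congrArg (fun f : lp (fun _ : X => ℂ) p => f y.1) h
  simp only [lp.single_apply_self] at h1
  by_cases hy : y.1 = y'.1
  · rw [hy, lp.single_apply_self] at h1
    exact Prod.ext hy (Circle.ext h1)
  · rw [lp.single_apply_ne _ _ _ hy] at h1
    exact absurd h1 (Circle.coe_ne_zero _)

theorem single_mul_circle (p : ℝ≥0∞) (x : X) (z w : Circle) :
    (lp.single p x ((z * w : Circle) : ℂ) : lp (fun _ : X => ℂ) p) =
      (w : ℂ) • lp.single p x (z : ℂ) := by
  rw [← lp.single_smul, smul_eq_mul, Circle.coe_mul, mul_comm]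

/-- The Banach–Lamperti theorem for representations: isometric representations on `ℓ_p`, `p ≠ 2`,
are monomial. -/
theorem exists_eq_rep {G : Type*} [Group G] (hp : 0 < p.toReal) (hpt : p ≠ ⊤)
    (hp2 : p.toReal ≠ 2) (π : G →* (lp (fun _ : X => ℂ) p ≃ₗᵢ[ℂ] lp (fun _ : X => ℂ) p)) :
    ∃ ρ : MonomialAction G X, π = ρ.rep p hp := by
  have hex : ∀ (g : G) (y : X × Circle), ∃ y' : X × Circle,
      π g (lp.single p y.1 (y.2 : ℂ)) = lp.single p y'.1 (y'.2 : ℂ) := fun g y => by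
    obtain ⟨x, z, h⟩ := exists_isometry_single_eq hp hpt hp2 (π g) y.1
    refine ⟨(x, z * y.2), ?_⟩
    rw [single_mul_circle, ← h, ← map_smul, ← lp.single_smul, smul_eq_mul, mul_one]
  choose m hm using hex
  -- A unimodular multiple of a basis vector determines its index and its phase, so multiplicativity
  -- and `Circle`-equivariance of `m` are inherited from the linear operators `π g`.
  have hinj := single_circle_injective (X := X) p
  let M : G →* Function.End (X × Circle) :=
    { toFun := m
      map_one' := by
        funext y
        refine hinj ?_
        simp only [← hm, map_one]
        rfl
      map_mul' := fun g h => by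
        funext y
        refine hinj ?_
        change (lp.single p (m (g * h) y).1 ((m (g * h) y).2 : ℂ) : lp (fun _ : X => ℂ) p) =
          lp.single p (m g (m h y)).1 ((m g (m h y)).2 : ℂ)
        rw [← hm, ← hm, ← hm, map_mul]
        rfl }
  let ρ : MonomialAction G X :=
    { toHom := M.toHomPerm
      map_mul_right := fun g x z w => by
        change m g (x, z * w) = ((m g (x, z)).1, (m g (x, z)).2 * w)
        refine hinj ?_
        simp only [single_mul_circle, ← hm, map_smul] }
  refine ⟨ρ, ?_⟩
  ext1 g
  have h : ((π g).toContinuousLinearEquiv : lp (fun _ : X => ℂ) p →L[ℂ] _) =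
      ((ρ.rep p hp g).toContinuousLinearEquiv :
        lp (fun _ : X => ℂ) p →L[ℂ] lp (fun _ : X => ℂ) p) := by
    refine lp.ext_continuousLinearMap hpt fun x => ?_
    ext1
    have h1 := ρ.rep_single p hp g (x, 1)
    have h2 := hm g (x, 1)
    simp only [Circle.coe_one] at h1 h2
    exact h2.trans h1.symm
  ext1 f
  exact congrArg (fun S : lp (fun _ : X => ℂ) p →L[ℂ] lp (fun _ : X => ℂ) p => S f) h

end Lamperti

/-! ### Open stabilizers -/

section Stabilizers

/-- The circle group has no small subgroups. -/
theorem circle_eq_one_of_norm_pow_sub_one_lt {z : Circle}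
    (h : ∀ n : ℕ, ‖(z : ℂ) ^ n - 1‖ < 1) : z = 1 := by
  -- For `‖w‖ = 1` and `‖w - 1‖ < 1`, the parallelogram law gives `‖w + 1‖² ≥ 3`, so squaring
  -- multiplies the squared distance to `1` by at least `3`.
  have key : ∀ n : ℕ, 3 ^ n * ‖(z : ℂ) - 1‖ ^ 2 ≤ ‖(z : ℂ) ^ (2 ^ n) - 1‖ ^ 2 := by
    intro n
    induction n with
    | zero => simp
    | succ n ih =>
      set w := (z : ℂ) ^ (2 ^ n) with hw
      have h1 : ‖w‖ = 1 := by rw [hw, norm_pow, Circle.norm_coe, one_pow]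
      have h2 := parallelogram_law_with_norm ℝ w 1
      rw [h1, norm_one] at h2
      have h3 : (z : ℂ) ^ (2 ^ (n + 1)) - 1 = (w - 1) * (w + 1) := by
        rw [pow_succ, pow_mul, ← hw]; ring
      have h4 := h (2 ^ n)
      rw [← hw] at h4
      rw [h3, norm_mul, mul_pow]
      have h5 : 3 ≤ ‖w + 1‖ ^ 2 := by nlinarith [norm_nonneg (w - 1)]
      calc 3 ^ (n + 1) * ‖(z : ℂ) - 1‖ ^ 2 = (3 ^ n * ‖(z : ℂ) - 1‖ ^ 2) * 3 := by ring
        _ ≤ ‖w - 1‖ ^ 2 * ‖w + 1‖ ^ 2 := by gcongr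
  by_contra hz
  have hpos : 0 < ‖(z : ℂ) - 1‖ ^ 2 := by
    have : (z : ℂ) - 1 ≠ 0 := fun h0 => hz (Circle.ext (by simpa using sub_eq_zero.1 h0))
    positivity
  obtain ⟨n, hn⟩ := pow_unbounded_of_one_lt (‖(z : ℂ) - 1‖ ^ 2)⁻¹ (by norm_num : (1 : ℝ) < 3)
  have h1 := key n
  have h2 : 1 < 3 ^ n * ‖(z : ℂ) - 1‖ ^ 2 := by
    rwa [inv_lt_iff_one_lt_mul₀ hpos] at hn
  have h3 := h (2 ^ n)
  nlinarith [norm_nonneg ((z : ℂ) ^ (2 ^ n) - 1)]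

/-- An open subgroup moves the unit vector attached to `y` by less than `1`, hence cannot change its
base point, as that would alter a coordinate by modulus `1`. Each element `g` of it thus acts on the
fibre by a factor `χ` all of whose powers are within `1` of `1`, so `χ = 1`. -/
theorem MonomialAction.isOpen_stabilizer {G X : Type*} [Group G] [TopologicalSpace G]
    [IsTopologicalGroup G] [LocallyCompactSpace G] [TotallyDisconnectedSpace G]
    (ρ : MonomialAction G X) {p : ℝ≥0∞} [Fact (1 ≤ p)] (hp : 0 < p.toReal)
    (hsc : IsStronglyContinuous (ρ.rep p hp)) (y : X × Circle) :
    IsOpen {g | ρ.toHom g y = y} := by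
  classical
  have hp0 : p ≠ 0 := (lt_of_lt_of_le one_pos (Fact.out : 1 ≤ p)).ne'
  let v : lp (fun _ : X => ℂ) p := lp.single p y.1 (y.2 : ℂ)
  have hV : {g | ‖ρ.rep p hp g v - v‖ < 1} ∈ nhds (1 : G) := by
    have hc : Continuous fun g => ‖ρ.rep p hp g v - v‖ := ((hsc v).sub continuous_const).norm
    exact (isOpen_Iio.preimage hc).mem_nhds (by simp)
  obtain ⟨V, -, hVsub⟩ := exists_openSubgroup_subset_of_mem_nhds hV
  have hcoord : ∀ g ∈ V, ‖(lp.single p (ρ.toHom g y).1 ((ρ.toHom g y).2 : ℂ) :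
      lp (fun _ : X => ℂ) p) y.1 - y.2‖ < 1 := fun g hg => by
    have h1 := lp.norm_apply_le_norm hp0 (ρ.rep p hp g v - v) y.1
    rw [lp.coeFn_sub, Pi.sub_apply, ρ.rep_single p hp g y] at h1
    simp only [v, lp.single_apply_self] at h1
    refine h1.trans_lt ?_
    have h2 : ‖ρ.rep p hp g v - v‖ < 1 := hVsub hg
    rwa [ρ.rep_single p hp g y] at h2
  have hfst : ∀ g ∈ V, (ρ.toHom g y).1 = y.1 := fun g hg => by
    by_contra hne
    have h1 := hcoord g hg
    rw [lp.single_apply_ne _ _ _ (Ne.symm hne)] at h1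
    rw [zero_sub, norm_neg, Circle.norm_coe] at h1
    exact lt_irrefl _ h1
  have hsnd : ∀ g ∈ V, ‖((ρ.toHom g y).2 : ℂ) - y.2‖ < 1 := fun g hg => by
    have h1 := hcoord g hg
    rwa [hfst g hg, lp.single_apply_self] at h1
  let S : Subgroup G :=
    { carrier := {g | ρ.toHom g y = y}
      mul_mem' := fun {a b} ha hb => by
        change ρ.toHom (a * b) y = y
        rw [ρ.map_mul_apply, hb, ha]
      one_mem' := by simp
      inv_mem' := fun {a} ha => by
        change ρ.toHom a⁻¹ y = y
        conv_lhs => rw [← (ha : ρ.toHom a y = y)]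
        exact ρ.map_inv_map a y }
  have hle : (V : Subgroup G) ≤ S := fun g hg => by
    obtain ⟨χ, hχ⟩ : ∃ χ : Circle, χ = (ρ.toHom g y).2 * y.2⁻¹ := ⟨_, rfl⟩
    have hgy : ∀ w, ρ.toHom g (y.1, w) = (y.1, χ * w) := fun w => by
      have h1 := ρ.map_mul_right g y.1 y.2 (y.2⁻¹ * w)
      rw [mul_inv_cancel_left, Prod.mk.eta, hfst g hg] at h1
      rw [h1, hχ, mul_assoc]
    have hpow : ∀ n : ℕ, ρ.toHom (g ^ n) y = (y.1, χ ^ n * y.2) := fun n => by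
      induction n with
      | zero => simp
      | succ n ih => rw [pow_succ', ρ.map_mul_apply, ih, hgy, pow_succ', mul_assoc]
    have hχ1 : χ = 1 := circle_eq_one_of_norm_pow_sub_one_lt fun n => by
      have h1 := hsnd (g ^ n) (V.pow_mem hg n)
      rw [hpow] at h1
      simp only [Circle.coe_mul, Circle.coe_pow] at h1
      have h2 : (χ : ℂ) ^ n * y.2 - y.2 = ((χ : ℂ) ^ n - 1) * y.2 := by ring
      rwa [h2, norm_mul, Circle.norm_coe, mul_one] at h1
    change ρ.toHom g y = y
    have := hgy y.2
    rwa [hχ1, one_mul] at this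
  exact Subgroup.isOpen_mono (H₁ := (V : Subgroup G)) (H₂ := S) hle V.isOpen

end Stabilizers

/-! ### Almost invariant functions on abelian groups -/

section Folner

variable {C : Type*} [CommGroup C]

/-- Elements are added to `B` one at a time: sum the previous function over the translates by `b ^
j`, `j < M`. The displacement by `b` telescopes to two terms against a mass multiplied by `M`, while
commutativity preserves the earlier estimates. -/
theorem exists_almost_invariant_mass (B : Finset C) {η : ℝ≥0∞} (hη : η ≠ 0) :
    ∃ φ : C → ℝ, (∀ z, 0 ≤ φ z) ∧ ∑' z, ‖φ z‖ₑ ≠ 0 ∧ ∑' z, ‖φ z‖ₑ ≠ ⊤ ∧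
      ∀ b ∈ B, ∑' z, ‖φ (z * b) - φ z‖ₑ ≤ η * ∑' z, ‖φ z‖ₑ := by
  classical
  induction B using Finset.induction_on with
  | empty =>
    have h : ∑' z : C, ‖(Pi.single 1 1 : C → ℝ) z‖ₑ = 1 := by
      rw [tsum_eq_single 1 fun z hz => by simp [Pi.single_eq_of_ne hz]]
      simp
    exact ⟨Pi.single 1 1, fun z => by
      by_cases hz : z = 1
      · subst hz; simp
      · simp [Pi.single_eq_of_ne hz], by rw [h]; simp, by rw [h]; simp, by simp⟩
  | insert b B hb ih =>
    obtain ⟨φ, h0, hN0, hNt, hφ⟩ := ih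
    obtain ⟨M, hM⟩ := ENNReal.exists_nat_mul_gt hη (b := 2) (by simp)
    set N := ∑' z, ‖φ z‖ₑ with hN
    have hshift : ∀ (f : C → ℝ) (c : C), ∑' z, ‖f (z * c)‖ₑ = ∑' z, ‖f z‖ₑ := fun f c =>
      (Equiv.mulRight c).tsum_eq fun z => ‖f z‖ₑ
    have hM0 : M ≠ 0 := by rintro rfl; simp at hM
    have hN' : ∑' z, ‖∑ j ∈ Finset.range M, φ (z * b ^ j)‖ₑ = M * N := by
      have h1 : ∀ z, ‖∑ j ∈ Finset.range M, φ (z * b ^ j)‖ₑ =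
          ∑ j ∈ Finset.range M, ‖φ (z * b ^ j)‖ₑ := fun z => by
        rw [Real.enorm_of_nonneg (Finset.sum_nonneg fun _ _ => h0 _),
          ENNReal.ofReal_sum_of_nonneg fun _ _ => h0 _]
        exact Finset.sum_congr rfl fun _ _ => (Real.enorm_of_nonneg (h0 _)).symm
      simp_rw [h1]
      rw [Summable.tsum_finsetSum fun _ _ => ENNReal.summable]
      simp_rw [hshift]
      simp [hN]
    refine ⟨fun z => ∑ j ∈ Finset.range M, φ (z * b ^ j), fun z => Finset.sum_nonneg fun _ _ => h0 _,
      ?_, ?_, fun c hc => ?_⟩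
    · rw [hN']; exact mul_ne_zero (by exact_mod_cast hM0) hN0
    · rw [hN']; exact ENNReal.mul_ne_top (by simp) hNt
    · rw [hN']
      rcases Finset.mem_insert.1 hc with rfl | hc
      · have h1 : ∀ z, (∑ j ∈ Finset.range M, φ (z * c * c ^ j)) -
            ∑ j ∈ Finset.range M, φ (z * c ^ j) = φ (z * c ^ M) - φ z := fun z => by
          rw [← Finset.sum_sub_distrib]
          have := Finset.sum_range_sub (fun j => φ (z * c ^ j)) M
          simp only [pow_zero, mul_one] at this
          rw [← this]
          exact Finset.sum_congr rfl fun j _ => by rw [pow_succ', mul_assoc]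
        simp_rw [h1]
        calc ∑' z, ‖φ (z * c ^ M) - φ z‖ₑ ≤ ∑' z, (‖φ (z * c ^ M)‖ₑ + ‖φ z‖ₑ) :=
              ENNReal.tsum_le_tsum fun z => enorm_sub_le
          _ = 2 * N := by rw [ENNReal.tsum_add, hshift, two_mul]
          _ ≤ M * η * N := by gcongr
          _ = η * (M * N) := by ring
      · calc ∑' z, ‖(∑ j ∈ Finset.range M, φ (z * c * b ^ j)) -
              ∑ j ∈ Finset.range M, φ (z * b ^ j)‖ₑ
            ≤ ∑' z, ∑ j ∈ Finset.range M, ‖φ (z * b ^ j * c) - φ (z * b ^ j)‖ₑ := by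
              refine ENNReal.tsum_le_tsum fun z => ?_
              rw [← Finset.sum_sub_distrib]
              refine (enorm_sum_le _ _).trans_eq (Finset.sum_congr rfl fun j _ => ?_)
              rw [mul_right_comm]
          _ = ∑ j ∈ Finset.range M, ∑' z, ‖φ (z * c) - φ z‖ₑ := by
              rw [Summable.tsum_finsetSum fun _ _ => ENNReal.summable]
              exact Finset.sum_congr rfl fun j _ => hshift (fun z => φ (z * c) - φ z) (b ^ j)
          _ = M * ∑' z, ‖φ (z * c) - φ z‖ₑ := by simp
          _ ≤ M * (η * N) := by gcongr; exact hφ c hc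
          _ = η * (M * N) := by ring

/-- Abelian groups are amenable: there are functions in `ℓ²` which are almost invariant under any
given finite set. -/
theorem exists_almost_invariant_energy (B : Finset C) {η : ℝ≥0∞} (hη : η ≠ 0) :
    ∃ ψ : C → ℂ, energy 2 ψ ≠ 0 ∧ energy 2 ψ ≠ ⊤ ∧
      ∀ b ∈ B, energy 2 (fun z => ψ (z * b) - ψ z) ≤ η * energy 2 ψ := by
  obtain ⟨φ, h0, hN0, hNt, hφ⟩ := exists_almost_invariant_mass B hη
  have hN : energy 2 (fun z => ((√(φ z) : ℝ) : ℂ)) = ∑' z, ‖φ z‖ₑ := by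
    unfold energy
    refine tsum_congr fun z => ?_
    rw [enorm_rpow_two, Complex.norm_real, Real.norm_eq_abs, sq_abs, Real.sq_sqrt (h0 z),
      Real.enorm_of_nonneg (h0 z)]
  refine ⟨fun z => (√(φ z) : ℝ), by rwa [hN], by rwa [hN], fun b hb => ?_⟩
  rw [hN]
  refine le_trans (ENNReal.tsum_le_tsum fun z => ?_) (hφ b hb)
  rw [enorm_rpow_two]
  beta_reduce
  rw [← Complex.ofReal_sub, Complex.norm_real, Real.norm_eq_abs, sq_abs,
    ← ofReal_norm, Real.norm_eq_abs]
  refine ENNReal.ofReal_le_ofReal ?_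
  -- Square roots turn almost invariance in `ℓ_1` into almost invariance in `ℓ_2`.
  have key : ∀ {a c : ℝ}, 0 ≤ a → 0 ≤ c → (√a - √c) ^ 2 ≤ |a - c| := fun {a c} ha hc => by
    have h1 := Real.sq_sqrt ha
    have h2 := Real.sq_sqrt hc
    have h3 := Real.sqrt_nonneg a
    have h4 := Real.sqrt_nonneg c
    rcases le_total (√a) (√c) with h | h
    · nlinarith [neg_abs_le (a - c), mul_nonneg h3 (sub_nonneg.2 h)]
    · nlinarith [le_abs_self (a - c), mul_nonneg h4 (sub_nonneg.2 h)]
  exact key (h0 _) (h0 _)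

end Folner

/-! ### Untwisting by a function of the phase -/

section Phase

/-- The phase of a complex number. -/
noncomputable def phase (v : ℂ) : Circle := Circle.exp v.arg

theorem norm_mul_phase (v : ℂ) : (‖v‖ : ℂ) * phase v = v := by
  simp [phase, Circle.coe_exp]

theorem phase_circle_mul (z : Circle) {v : ℂ} (hv : v ≠ 0) : phase (z * v) = z * phase v := by
  refine Circle.ext (mul_left_cancel₀ (a := (‖v‖ : ℂ)) (by simpa using hv) ?_)
  have h := norm_mul_phase (z * v)
  rw [norm_mul, Circle.norm_coe, one_mul] at h
  rw [h, Circle.coe_mul, mul_left_comm, norm_mul_phase]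

/-- The function `v ↦ ‖v‖ ψ(phase v)`. -/
noncomputable def phaseWeight (ψ : Circle → ℂ) (v : ℂ) : ℂ := ‖v‖ * ψ (phase v)

theorem phaseWeight_zero (ψ : Circle → ℂ) : phaseWeight ψ 0 = 0 := by simp [phaseWeight]

theorem phaseWeight_circle_mul (ψ : Circle → ℂ) (z : Circle) (v : ℂ) :
    phaseWeight ψ (z * v) = ‖v‖ * ψ (z * phase v) := by
  rcases eq_or_ne v 0 with rfl | hv
  · simp [phaseWeight]
  · rw [phaseWeight, phase_circle_mul z hv, norm_mul, Circle.norm_coe, one_mul]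

theorem energy_const_mul_shift (ψ : Circle → ℂ) (a : ℂ) (c : Circle) :
    energy 2 (fun z : Circle => a * ψ (z⁻¹ * c)) = ‖a‖ₑ ^ (2 : ℝ) * energy 2 ψ := by
  rw [energy_const_mul two_pos.le]
  congr 1
  exact energy_comp_equiv 2 ((Equiv.inv Circle).trans (Equiv.mulRight c)) ψ

theorem enorm_ofReal_norm (v : ℂ) : ‖(‖v‖ : ℂ)‖ₑ = ‖v‖ₑ := by
  rw [← ofReal_norm, Complex.norm_real, norm_norm, ofReal_norm]

theorem energy_phaseWeight (ψ : Circle → ℂ) (v : ℂ) :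
    energy 2 (fun z : Circle => phaseWeight ψ ((z⁻¹ : Circle) * v)) =
      ‖v‖ₑ ^ (2 : ℝ) * energy 2 ψ := by
  simp_rw [phaseWeight_circle_mul]
  rw [energy_const_mul_shift, enorm_ofReal_norm]

theorem energy_two_sub_le {X : Type*} (f g : X → ℂ) :
    energy 2 (fun x => f x - g x) ≤ 2 * (energy 2 f + energy 2 g) := by
  refine (energy_sub_le one_le_two f g).trans_eq ?_
  norm_num

theorem energy_phaseWeight_sub_le (ψ : Circle → ℂ) (v w : ℂ) :
    energy 2 (fun z : Circle => phaseWeight ψ ((z⁻¹ : Circle) * v) -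
        phaseWeight ψ ((z⁻¹ : Circle) * w)) ≤
      energy 2 ψ * (2 * (‖v‖ₑ ^ (2 : ℝ) + ‖w‖ₑ ^ (2 : ℝ))) := by
  refine (energy_two_sub_le _ _).trans_eq ?_
  rw [energy_phaseWeight, energy_phaseWeight]; ring

/-- The difference splits into a change of modulus, bounded by `‖v - w‖`, and a change of phase,
which translates `ψ` by the ratio of the phases and is controlled by its almost invariance. -/
theorem energy_phaseWeight_sub_le_of_phase (ψ : Circle → ℂ) {η : ℝ≥0∞} (v w : ℂ)
    (h : energy 2 (fun z => ψ (z * (phase v * (phase w)⁻¹)) - ψ z) ≤ η * energy 2 ψ) :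
    energy 2 (fun z : Circle => phaseWeight ψ ((z⁻¹ : Circle) * v) -
        phaseWeight ψ ((z⁻¹ : Circle) * w)) ≤
      energy 2 ψ * (2 * ‖v - w‖ₑ ^ (2 : ℝ) + 2 * η * ‖w‖ₑ ^ (2 : ℝ)) := by
  simp_rw [phaseWeight_circle_mul]
  have h1 : ∀ z : Circle, (‖v‖ : ℂ) * ψ (z⁻¹ * phase v) - ‖w‖ * ψ (z⁻¹ * phase w) =
      ((‖v‖ - ‖w‖ : ℝ) : ℂ) * ψ (z⁻¹ * phase v) -
        (-‖w‖ : ℂ) * (ψ (z⁻¹ * phase w * (phase v * (phase w)⁻¹)) - ψ (z⁻¹ * phase w)) := fun z => by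
    have : z⁻¹ * phase w * (phase v * (phase w)⁻¹) = z⁻¹ * phase v := by
      rw [mul_comm (phase v), mul_assoc, mul_inv_cancel_left]
    rw [this]; push_cast; ring
  simp_rw [h1]
  refine (energy_two_sub_le _ _).trans ?_
  rw [energy_const_mul_shift,
    energy_const_mul_shift (fun z => ψ (z * (phase v * (phase w)⁻¹)) - ψ z), enorm_neg,
    enorm_ofReal_norm]
  have h2 : ‖((‖v‖ - ‖w‖ : ℝ) : ℂ)‖ₑ ≤ ‖v - w‖ₑ := by
    rw [← ofReal_norm, ← ofReal_norm, Complex.norm_real]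
    exact ENNReal.ofReal_le_ofReal (abs_norm_sub_norm_le v w)
  calc _ ≤ 2 * (‖v - w‖ₑ ^ (2 : ℝ) * energy 2 ψ + ‖w‖ₑ ^ (2 : ℝ) * (η * energy 2 ψ)) := by
        gcongr
    _ = _ := by ring

end Phase

namespace MonomialAction

variable {G X : Type*} [Group G] (ρ : MonomialAction G X)

theorem energy_phaseWeight_twist (ψ : Circle → ℂ) (w : X → ℂ) :
    energy 2 (fun y => phaseWeight ψ (twist w y)) = energy 2 ψ * energy 2 w := by
  unfold energy
  rw [ENNReal.tsum_prod', ← ENNReal.tsum_mul_left]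
  refine tsum_congr fun x => ?_
  rw [mul_comm]
  exact energy_phaseWeight ψ (w x)

/-- Almost invariant functions for a monomial action give almost invariant functions on the set
`X × Circle`. -/
theorem exists_phaseWeight_displacement_lt (w : X → ℂ) (S : Finset G) {ε : ℝ≥0∞} (hε : ε ≠ ⊤)
    (hw : energy 2 w ≠ ⊤)
    (h : ∑ s ∈ S, energy 2 (fun x => ρ.act s w x - w x) < ε * energy 2 w) :
    ∃ ψ : Circle → ℂ, energy 2 (fun y => phaseWeight ψ (twist w y)) ≠ ⊤ ∧
      ∑ s ∈ S, energy 2 (fun y => phaseWeight ψ (twist w (ρ.toHom s⁻¹ y)) -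
        phaseWeight ψ (twist w y)) < 4 * ε * energy 2 (fun y => phaseWeight ψ (twist w y)) := by
  classical
  have hεe : ε * energy 2 w ≠ 0 := (bot_le.trans_lt h).ne'
  have hε0 : ε ≠ 0 := left_ne_zero_of_mul hεe
  have hεet : ε * energy 2 w ≠ ⊤ := ENNReal.mul_ne_top hε hw
  set t : G → X → ℝ≥0∞ := fun s x => ‖ρ.act s w x‖ₑ ^ (2 : ℝ) + ‖w x‖ₑ ^ (2 : ℝ) with ht
  have htsum : ∑' x, ∑ s ∈ S, t s x ≠ ⊤ := by
    rw [Summable.tsum_finsetSum fun _ _ => ENNReal.summable]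
    refine (ENNReal.sum_lt_top.2 fun s _ => ?_).ne
    rw [ENNReal.tsum_add]
    exact ENNReal.add_lt_top.2 ⟨(ρ.energy_act 2 s w).trans_lt hw.lt_top, hw.lt_top⟩
  -- Infinitely many phase ratios may occur, but `ψ` can be almost invariant only under finitely
  -- many prescribed ones. Outside the finite set `E` the crude bound `energy_phaseWeight_sub_le`
  -- suffices, because the tail is small.
  obtain ⟨E, hE⟩ : ∃ E : Finset X, ∑' x : {x // x ∉ E}, ∑ s ∈ S, t s x < ε * energy 2 w / 2 :=
    ((ENNReal.tendsto_tsum_compl_atTop_zero htsum).eventually_lt_const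
      (ENNReal.half_pos hεe)).exists
  -- Summed over `S`, the phase terms then cost at most `ε`. The constant `4` is `2` from the
  -- modulus terms, `1` from the phases and `1` from the tail.
  set η : ℝ≥0∞ := ε / (2 * (S.card + 1)) with hη
  have hη0 : η ≠ 0 := ENNReal.div_ne_zero.2 ⟨hε0, by finiteness⟩
  obtain ⟨ψ, hψ0, hψt, hψ⟩ := exists_almost_invariant_energy
    ((S ×ˢ E).image fun q => phase (ρ.act q.1 w q.2) * (phase (w q.2))⁻¹) hη0
  refine ⟨ψ, by rw [energy_phaseWeight_twist]; exact ENNReal.mul_ne_top hψt hw, ?_⟩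
  have hpt : ∀ s ∈ S, ∀ x,
      energy 2 (fun z : Circle => phaseWeight ψ ((z⁻¹ : Circle) * ρ.act s w x) -
        phaseWeight ψ ((z⁻¹ : Circle) * w x)) ≤
      energy 2 ψ * (2 * ‖ρ.act s w x - w x‖ₑ ^ (2 : ℝ) + 2 * η * ‖w x‖ₑ ^ (2 : ℝ) +
        2 * {x | x ∉ E}.indicator (t s) x) := by
    intro s hs x
    by_cases hx : x ∈ E
    · refine (energy_phaseWeight_sub_le_of_phase ψ (η := η) _ _ (hψ _ ?_)).trans ?_
      · exact Finset.mem_image.2 ⟨(s, x), Finset.mem_product.2 ⟨hs, hx⟩, rfl⟩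
      · exact mul_le_mul' le_rfl le_self_add
    · refine (energy_phaseWeight_sub_le ψ _ _).trans ?_
      gcongr
      rw [Set.indicator_of_mem (show x ∈ {x | x ∉ E} from hx)]
      exact le_add_self
  have hsum : ∀ s ∈ S, energy 2 (fun y => phaseWeight ψ (twist w (ρ.toHom s⁻¹ y)) -
      phaseWeight ψ (twist w y)) ≤
      energy 2 ψ * (2 * energy 2 (fun x => ρ.act s w x - w x) + 2 * η * energy 2 w +
        2 * ∑' x, {x | x ∉ E}.indicator (t s) x) := by
    intro s hs
    simp_rw [← twist_act]
    unfold energy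
    rw [ENNReal.tsum_prod', ← ENNReal.tsum_mul_left, ← ENNReal.tsum_mul_left,
      ← ENNReal.tsum_mul_left, ← ENNReal.tsum_add, ← ENNReal.tsum_add, ← ENNReal.tsum_mul_left]
    exact ENNReal.tsum_le_tsum (hpt s hs)
  rw [energy_phaseWeight_twist]
  refine (Finset.sum_le_sum hsum).trans_lt ?_
  rw [← Finset.mul_sum, mul_left_comm]
  refine ENNReal.mul_lt_mul_right hψ0 hψt ?_
  have hre : ∑ s ∈ S, (2 * energy 2 (fun x => ρ.act s w x - w x) + 2 * η * energy 2 w +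
      2 * ∑' x, {x | x ∉ E}.indicator (t s) x) =
      2 * ∑ s ∈ S, energy 2 (fun x => ρ.act s w x - w x) + ∑ _s ∈ S, 2 * η * energy 2 w +
      2 * ∑' x, ∑ s ∈ S, {x | x ∉ E}.indicator (t s) x := by
    rw [Summable.tsum_finsetSum fun _ _ => ENNReal.summable]
    simp only [Finset.sum_add_distrib, Finset.mul_sum]
  rw [hre]
  have h1 : ∑' x, ∑ s ∈ S, {x | x ∉ E}.indicator (t s) x ≤ ε * energy 2 w / 2 := by
    refine le_trans (le_of_eq ?_) hE.le
    refine Eq.trans ?_ (tsum_subtype {x | x ∉ E} fun x => ∑ s ∈ S, t s x).symm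
    refine tsum_congr fun x => ?_
    by_cases hx : x ∈ E <;> simp [hx]
  have h2 : ∑ _s ∈ S, 2 * η * energy 2 w ≤ ε * energy 2 w := by
    rw [Finset.sum_const, nsmul_eq_mul]
    calc (S.card : ℝ≥0∞) * (2 * η * energy 2 w) = (2 * S.card) * η * energy 2 w := by ring
      _ ≤ (2 * (S.card + 1)) * η * energy 2 w := by gcongr; exact le_self_add
      _ ≤ ε * energy 2 w := by gcongr; exact ENNReal.mul_div_le
  calc _ ≤ 2 * ∑ s ∈ S, energy 2 (fun x => ρ.act s w x - w x) + ε * energy 2 w +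
        2 * (ε * energy 2 w / 2) := by gcongr
    _ = 2 * ∑ s ∈ S, energy 2 (fun x => ρ.act s w x - w x) + (ε * energy 2 w + ε * energy 2 w) := by
        rw [ENNReal.mul_div_cancel (by simp) (by simp), add_assoc]
    _ < 2 * (ε * energy 2 w) + (ε * energy 2 w + ε * energy 2 w) :=
        ENNReal.add_lt_add_right (by finiteness) (ENNReal.mul_lt_mul_right (by simp) (by simp) h)
    _ = 4 * ε * energy 2 w := by ring

end MonomialAction

/-! ### Orbits of a monomial action -/

section Orbits

namespace MonomialAction

variable {G X : Type*} [Group G] (ρ : MonomialAction G X)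

theorem base_mul_apply (g h : G) (x : X) : ρ.base (g * h) x = ρ.base g (ρ.base h x) := by
  rw [map_mul]; rfl

/-- The orbit of a point of `X × Circle`. -/
def orbit (y : X × Circle) : Set (X × Circle) := Set.range fun g => ρ.toHom g y

/-- The orbit of a point of `X`. -/
def baseOrbit (x : X) : Set X := Set.range fun g => ρ.base g x

theorem mem_orbit_iff {y y' : X × Circle} (g : G) :
    ρ.toHom g y' ∈ ρ.orbit y ↔ y' ∈ ρ.orbit y := by
  constructor
  · rintro ⟨h, hh⟩
    refine ⟨g⁻¹ * h, ?_⟩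
    change ρ.toHom (g⁻¹ * h) y = y'
    rw [map_mul_apply, show ρ.toHom h y = _ from hh, map_inv_map]
  · rintro ⟨h, rfl⟩
    exact ⟨g * h, ρ.map_mul_apply g h y⟩

theorem mem_baseOrbit_iff {x x' : X} (g : G) :
    ρ.base g x' ∈ ρ.baseOrbit x ↔ x' ∈ ρ.baseOrbit x := by
  constructor
  · rintro ⟨h, hh⟩
    refine ⟨g⁻¹ * h, ?_⟩
    change ρ.base (g⁻¹ * h) x = x'
    rw [base_mul_apply, show ρ.base h x = _ from hh, ← base_mul_apply, inv_mul_cancel, map_one]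
    rfl
  · rintro ⟨h, rfl⟩
    exact ⟨g * h, ρ.base_mul_apply g h x⟩

theorem baseOrbit_eq {x x' : X} (h : x' ∈ ρ.baseOrbit x) : ρ.baseOrbit x' = ρ.baseOrbit x := by
  obtain ⟨g, rfl⟩ := h
  ext a
  constructor
  · rintro ⟨k, rfl⟩
    exact ⟨k * g, ρ.base_mul_apply k g x⟩
  · rintro ⟨k, rfl⟩
    refine ⟨k * g⁻¹, ?_⟩
    change ρ.base (k * g⁻¹) (ρ.base g x) = _
    rw [← base_mul_apply, inv_mul_cancel_right]

/-- Sums over a finite orbit in `X × Circle` are multiples of sums over its projection. -/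
theorem exists_tsum_orbit_eq {y : X × Circle} (hy : (ρ.orbit y).Finite) :
    ∃ m : ℝ≥0∞, m ≠ 0 ∧ m ≠ ⊤ ∧ ∀ a : X → ℝ≥0∞,
      ∑' q : X × Circle, (ρ.orbit y).indicator (fun q => a q.1) q =
        m * ∑' x, (ρ.baseOrbit y.1).indicator a x := by
  classical
  have hyy : y ∈ ρ.orbit y := ⟨1, by simp⟩
  -- The number of points of the orbit above `x`. An element of `G` maps fibres to fibres by
  -- rotations, so this is constant on the base orbit; its value there is the multiple `m`.
  let n : X → ℝ≥0∞ := fun x => ∑' z : Circle, (ρ.orbit y).indicator 1 (x, z)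
  have hn : ∀ x ∈ ρ.baseOrbit y.1, n x = n y.1 := by
    rintro _ ⟨g, rfl⟩
    let c := (ρ.toHom g (y.1, 1)).2
    have h1 : ∀ z, ρ.toHom g (y.1, z) = (ρ.base g y.1, c * z) := fun z => ρ.map_eq g y.1 z
    change n (ρ.base g y.1) = n y.1
    simp only [n]
    rw [← (Equiv.mulLeft c).tsum_eq]
    refine tsum_congr fun z => ?_
    rw [Equiv.coe_mulLeft, ← h1]
    simp only [Set.indicator_apply, mem_orbit_iff, Pi.one_apply]
  have hn0 : ∀ x ∉ ρ.baseOrbit y.1, n x = 0 := fun x hx => by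
    simp only [n, ENNReal.tsum_eq_zero]
    intro z
    refine Set.indicator_of_notMem (fun hz => hx ?_) _
    obtain ⟨g, hg⟩ := hz
    refine ⟨g, (ρ.fst_map g y).symm.trans ?_⟩
    exact congrArg Prod.fst hg
  refine ⟨n y.1, ?_, ?_, fun a => ?_⟩
  · intro h
    have := ENNReal.tsum_eq_zero.1 h y.2
    simp [hyy] at this
  · have hle : n y.1 ≤ ∑' q, (ρ.orbit y).indicator (1 : X × Circle → ℝ≥0∞) q := by
      rw [ENNReal.tsum_prod']
      exact ENNReal.le_tsum y.1
    refine ne_top_of_le_ne_top ?_ hle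
    rw [← tsum_subtype]
    have := hy.fintype
    rw [tsum_fintype]
    simp
  · rw [ENNReal.tsum_prod', ← ENNReal.tsum_mul_left]
    refine tsum_congr fun x => ?_
    have h1 : ∀ z : Circle, (ρ.orbit y).indicator (fun q => a q.1) (x, z) =
        (ρ.orbit y).indicator 1 (x, z) * a x := fun z => by
      by_cases hz : (x, z) ∈ ρ.orbit y <;> simp [hz]
    simp_rw [h1]
    rw [ENNReal.tsum_mul_right]
    change n x * a x = _
    by_cases hx : x ∈ ρ.baseOrbit y.1
    · rw [hn x hx, Set.indicator_of_mem hx]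
    · rw [hn0 x hx, Set.indicator_of_notMem hx]; simp

end MonomialAction

end Orbits

namespace MonomialAction

variable {G X : Type*} [Group G] (ρ : MonomialAction G X)

theorem fst_mem_baseOrbit_iff (x : X) (g : G) (y : X × Circle) :
    (ρ.toHom g y).1 ∈ ρ.baseOrbit x ↔ y.1 ∈ ρ.baseOrbit x := by
  rw [fst_map, mem_baseOrbit_iff]

theorem twist_indicator (T : Set X) (w : X → ℂ) (y : X × Circle) :
    twist (T.indicator w) y = (Prod.fst ⁻¹' T).indicator (twist w) y := by
  by_cases h : y.1 ∈ T <;> simp [twist, h]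

theorem act_indicator (x₀ : X) (g : G) (w : X → ℂ) :
    ρ.act g ((ρ.baseOrbit x₀).indicator w) = (ρ.baseOrbit x₀).indicator (ρ.act g w) := by
  ext x
  have h := ρ.fst_mem_baseOrbit_iff x₀ g⁻¹ (x, 1)
  rw [act, twist_indicator]
  by_cases hx : x ∈ ρ.baseOrbit x₀
  · rw [Set.indicator_of_mem (show _ ∈ Prod.fst ⁻¹' ρ.baseOrbit x₀ from h.2 hx), Set.indicator_of_mem hx, act]
  · rw [Set.indicator_of_notMem (show _ ∉ Prod.fst ⁻¹' ρ.baseOrbit x₀ from fun h' => hx (h.1 h')),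
      Set.indicator_of_notMem hx]

theorem norm_twist (w : X → ℂ) (y : X × Circle) : ‖twist w y‖ = ‖w y.1‖ := by
  rw [twist, norm_mul, Circle.norm_coe, one_mul]

theorem energy_indicator (s : Set X) (f : X → ℂ) :
    energy 2 (s.indicator f) = ∑' x, s.indicator (fun x => ‖f x‖ₑ ^ (2 : ℝ)) x := by
  refine tsum_congr fun x => ?_
  by_cases hx : x ∈ s <;> simp [hx]

theorem enorm_twist (w : X → ℂ) (y : X × Circle) : ‖twist w y‖ₑ = ‖w y.1‖ₑ := by
  rw [← ofReal_norm, norm_twist, ofReal_norm]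

/-- Almost invariant functions for a monomial action with open stabilizers, orthogonal to the
invariant functions, give such functions on a coset space. -/
theorem exists_coset_function_of_act [TopologicalSpace G]
    (hst : ∀ y, IsOpen {g | ρ.toHom g y = y}) (U : Subgroup G) (S : Finset G) {ε : ℝ≥0∞}
    (hε : ε ≠ ⊤) (w : X → ℂ) (hU : ∀ u ∈ U, ρ.act u w = w) (hw : energy 2 w ≠ ⊤)
    (h0 : ∀ y, (ρ.orbit y).Finite → ∑' q : ρ.orbit y, twist w q = 0)
    (hlt : ∑ s ∈ S, energy 2 (fun x => ρ.act s w x - w x) < ε * energy 2 w) :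
    ∃ (H : OpenSubgroup G) (f : G ⧸ (H : Subgroup G) → ℂ),
      (∀ u ∈ U, ∀ x, f (u • x) = f x) ∧ energy 2 f ≠ ⊤ ∧
      (Finite (G ⧸ (H : Subgroup G)) → ∑' x, f x = 0) ∧
      ∑ s ∈ S, energy 2 (fun x => f (s⁻¹ • x) - f x) < 4 * ε * energy 2 f := by
  classical
  let _ : MulAction G (X × Circle) := MulAction.compHom _ ρ.toHom
  have hstab : ∀ y : X × Circle, IsOpen (MulAction.stabilizer G y : Set G) := hst
  unfold energy at hlt
  rw [← Summable.tsum_finsetSum (fun _ _ => ENNReal.summable), ← ENNReal.tsum_mul_left] at hlt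
  obtain ⟨c, hc⟩ := exists_fiber_tsum_lt ρ.baseOrbit hlt
  have hne : (ρ.baseOrbit ⁻¹' {c}).Nonempty := by
    by_contra hn
    rw [Set.not_nonempty_iff_eq_empty] at hn
    rw [hn] at hc
    simp at hc
  obtain ⟨x₀, rfl⟩ := hne
  have hfib : ρ.baseOrbit ⁻¹' {ρ.baseOrbit x₀} = ρ.baseOrbit x₀ := by
    ext x
    refine ⟨fun hx => ?_, fun hx => ρ.baseOrbit_eq hx⟩
    rw [← (hx : ρ.baseOrbit x = ρ.baseOrbit x₀)]
    exact ⟨1, by simp⟩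
  rw [hfib, tsum_subtype (ρ.baseOrbit x₀) fun x => ∑ s ∈ S, ‖ρ.act s w x - w x‖ₑ ^ (2 : ℝ),
    tsum_subtype (ρ.baseOrbit x₀) fun x => ε * ‖w x‖ₑ ^ (2 : ℝ)] at hc
  have hle : ∀ {a b : ℝ≥0∞}, a < ε * b → a < 4 * ε * b := fun {a b} h => h.trans_le (by
    rw [mul_assoc]; exact le_mul_of_one_le_left zero_le (by norm_num))
  -- Above a finite orbit, `twist w` restricted to that orbit has finite energy and mean zero, and
  -- all energies are multiplied by the same `m`. Otherwise the mean condition is void on every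
  -- orbit that matters, but `twist w` need not have finite energy, so it is composed with a phase
  -- weight.
  by_cases hfin : ∃ y : X × Circle, y.1 ∈ ρ.baseOrbit x₀ ∧ (ρ.orbit y).Finite
  · obtain ⟨y, hyT, hy⟩ := hfin
    rw [← ρ.baseOrbit_eq hyT] at hc
    obtain ⟨m, hm0, hmt, hm⟩ := ρ.exists_tsum_orbit_eq hy
    set F : X × Circle → ℂ := (ρ.orbit y).indicator (twist w) with hF
    have hFe : energy 2 F = m * ∑' x, (ρ.baseOrbit y.1).indicator (fun x => ‖w x‖ₑ ^ (2 : ℝ)) x := by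
      rw [hF, energy_indicator, ← hm]
      simp_rw [enorm_twist]
    have hFs : ∀ s q, F (ρ.toHom s⁻¹ q) - F q =
        (ρ.orbit y).indicator (twist (fun x => ρ.act s w x - w x)) q := fun s q => by
      by_cases hq : q ∈ ρ.orbit y
      · rw [hF, Set.indicator_of_mem ((ρ.mem_orbit_iff s⁻¹).2 hq), Set.indicator_of_mem hq,
          Set.indicator_of_mem hq, ← twist_act, twist, twist, twist, mul_sub]
      · rw [hF, Set.indicator_of_notMem (fun h => hq ((ρ.mem_orbit_iff s⁻¹).1 h)),
          Set.indicator_of_notMem hq, Set.indicator_of_notMem hq, sub_zero]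
    refine exists_coset_function hstab U S (4 * ε) F (fun u hu q => ?_) ?_ (fun q hq => ?_) (hle ?_)
    · change F (ρ.toHom u q) = F q
      have h1 := hFs u⁻¹ q
      rw [inv_inv, hU _ (U.inv_mem hu)] at h1
      refine sub_eq_zero.1 (h1.trans ?_)
      simp [Set.indicator_apply, twist]
    · rw [hFe]
      refine ENNReal.mul_ne_top hmt (ne_top_of_le_ne_top hw ?_)
      exact ENNReal.tsum_le_tsum fun x => Set.indicator_le_self _ _ _
    · change ∑' q' : ρ.orbit q, F q' = 0
      have hmem : ∀ q' : ρ.orbit q, (q' : X × Circle) ∈ ρ.orbit y ↔ q ∈ ρ.orbit y := by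
        rintro ⟨_, ⟨g, rfl⟩⟩
        exact ρ.mem_orbit_iff g
      by_cases hqy : q ∈ ρ.orbit y
      · rw [← h0 q hq]
        exact tsum_congr fun q' => Set.indicator_of_mem ((hmem q').2 hqy) _
      · rw [tsum_congr fun q' => Set.indicator_of_notMem (fun h => hqy ((hmem q').1 h)) _, tsum_zero]
    · have h1 : ∀ s ∈ S, energy 2 (fun q => F (s⁻¹ • q) - F q) =
          m * ∑' x, (ρ.baseOrbit y.1).indicator (fun x => ‖ρ.act s w x - w x‖ₑ ^ (2 : ℝ)) x :=
        fun s _ => by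
          have h2 : energy 2 (fun q => F (s⁻¹ • q) - F q) =
              energy 2 ((ρ.orbit y).indicator (twist (fun x => ρ.act s w x - w x))) := by
            congr 1; ext q; exact hFs s q
          rw [h2, energy_indicator, ← hm]
          simp_rw [enorm_twist]
      rw [Finset.sum_congr rfl h1, hFe, ← Finset.mul_sum, mul_left_comm]
      refine ENNReal.mul_lt_mul_right hm0 hmt ?_
      rw [← Summable.tsum_finsetSum (fun _ _ => ENNReal.summable), ← ENNReal.tsum_mul_left]
      refine lt_of_eq_of_lt (tsum_congr fun x => ?_) (hc.trans_eq (tsum_congr fun x => ?_))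
      · by_cases hx : x ∈ ρ.baseOrbit y.1 <;> simp [hx]
      · by_cases hx : x ∈ ρ.baseOrbit y.1 <;> simp [hx]
  · push Not at hfin
    set w₁ := (ρ.baseOrbit x₀).indicator w with hw₁
    have hw₁e : energy 2 w₁ ≠ ⊤ := by
      refine ne_top_of_le_ne_top hw ?_
      rw [hw₁, energy_indicator]
      exact ENNReal.tsum_le_tsum fun x => Set.indicator_le_self _ _ _
    have hlt₁ : ∑ s ∈ S, energy 2 (fun x => ρ.act s w₁ x - w₁ x) < ε * energy 2 w₁ := by
      have h1 : ∀ s, (fun x => ρ.act s w₁ x - w₁ x) =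
          (ρ.baseOrbit x₀).indicator (fun x => ρ.act s w x - w x) := fun s => by
        ext x
        rw [hw₁, act_indicator]
        by_cases hx : x ∈ ρ.baseOrbit x₀ <;> simp [hx]
      simp_rw [h1, hw₁, energy_indicator]
      rw [← Summable.tsum_finsetSum (fun _ _ => ENNReal.summable), ← ENNReal.tsum_mul_left]
      refine lt_of_eq_of_lt (tsum_congr fun x => ?_) (hc.trans_eq (tsum_congr fun x => ?_))
      · by_cases hx : x ∈ ρ.baseOrbit x₀ <;> simp [hx]
      · by_cases hx : x ∈ ρ.baseOrbit x₀ <;> simp [hx]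
    obtain ⟨ψ, hψt, hψ⟩ := ρ.exists_phaseWeight_displacement_lt w₁ S hε hw₁e hlt₁
    refine exists_coset_function hstab U S (4 * ε) _ (fun u hu q => ?_) hψt (fun q hq => ?_) hψ
    · change phaseWeight ψ (twist w₁ (ρ.toHom u q)) = phaseWeight ψ (twist w₁ q)
      have h1 := ρ.twist_act u⁻¹ w₁ q
      rw [inv_inv, hw₁, act_indicator, hU _ (U.inv_mem hu)] at h1
      rw [hw₁, h1]
    · change ∑' q' : ρ.orbit q, phaseWeight ψ (twist w₁ q') = 0
      -- A finite orbit does not meet the part above the base orbit of `x₀`, where `w₁` is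
      -- supported.
      have hqT : q.1 ∉ ρ.baseOrbit x₀ := fun h => hfin q h hq
      have h1 : ∀ q' : ρ.orbit q, phaseWeight ψ (twist w₁ q') = 0 := by
        rintro ⟨_, ⟨g, rfl⟩⟩
        rw [hw₁, twist_indicator, Set.indicator_of_notMem, phaseWeight_zero]
        exact fun h => hqT ((ρ.fst_mem_baseOrbit_iff x₀ g q).1 h)
      simp [h1]

/-- Functions orthogonal to the invariant vectors have mean zero on finite orbits. -/
theorem tsum_orbit_twist_eq_zero (h2 : 0 < (2 : ℝ≥0∞).toReal) {w : lp (fun _ : X => ℂ) 2}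
    (hw : w ∈ (invariantVectors (ρ.rep 2 h2))ᗮ) {y : X × Circle} (hy : (ρ.orbit y).Finite) :
    ∑' q : ρ.orbit y, twist w q = 0 := by
  classical
  -- The group permutes the terms of this sum, so `v` is invariant; its inner product with `w` is
  -- the sum of `twist w` over the orbit.
  let v : lp (fun _ : X => ℂ) 2 := ∑ q ∈ hy.toFinset, lp.single 2 q.1 (q.2 : ℂ)
  have hv : v ∈ invariantVectors (ρ.rep 2 h2) := fun g => by
    change ρ.rep 2 h2 g (∑ q ∈ hy.toFinset, lp.single 2 q.1 (q.2 : ℂ)) = _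
    rw [map_sum, Finset.sum_congr rfl fun q _ => ρ.rep_single 2 h2 g q]
    refine Finset.sum_bij (fun q _ => ρ.toHom g q) (fun q hq => ?_) (fun _ _ _ _ h =>
      (ρ.toHom g).injective h) (fun q hq => ⟨ρ.toHom g⁻¹ q, ?_, ρ.map_map_inv g q⟩) fun _ _ => rfl
    · rw [Set.Finite.mem_toFinset] at hq ⊢
      exact (ρ.mem_orbit_iff g).2 hq
    · rw [Set.Finite.mem_toFinset] at hq ⊢
      exact (ρ.mem_orbit_iff g⁻¹).2 hq
  have h := (Submodule.mem_orthogonal _ _).1 hw v hv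
  rw [sum_inner] at h
  have h1 : ∀ q : X × Circle, inner ℂ (lp.single 2 q.1 (q.2 : ℂ) : lp (fun _ : X => ℂ) 2) w =
      twist w q := fun q => by
    rw [lp.inner_single_left, RCLike.inner_apply, twist, mul_comm, Circle.coe_inv_eq_conj]
  simp_rw [h1] at h
  rw [← h, ← Finset.tsum_subtype' hy.toFinset (twist w), hy.coe_toFinset]

end MonomialAction

/-! ### Duality between `ℓ_p` and `ℓ_q`, and distance to invariant vectors -/

section Duality

variable {X : Type*} {p : ℝ≥0∞} [Fact (1 ≤ p)]

/-- Functions in `ℓ_q` define functionals on `ℓ_p`. -/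
theorem exists_functional {q : ℝ≥0∞} [Fact (1 ≤ q)] (hpq : p.toReal.HolderConjugate q.toReal)
    (b : lp (fun _ : X => ℂ) q) :
    ∃ φ : StrongDual ℂ (lp (fun _ : X => ℂ) p), ∀ h, φ h = ∑' x, (starRingEnd ℂ) (b x) * h x := by
  have : q.HolderConjugate p := ENNReal.HolderConjugate.of_toReal hpq.symm
  have hB : ∀ _ : X, ‖ContinuousLinearMap.mul ℂ ℂ‖ ≤ ((1 : NNReal) : ℝ) := fun _ => by simp
  exact ⟨lp.dualPairing q p (fun _ : X => ContinuousLinearMap.mul ℂ ℂ) hB (star b), fun h =>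
    (lp.dualPairing_apply ..).trans (tsum_congr fun x => by simp)⟩

theorem conj_mazur_mul_mazur {s t : ℝ} (hst : s + t = 2) (v : ℂ) :
    (starRingEnd ℂ) (mazur s v) * mazur t v = ((‖v‖ ^ 2 : ℝ) : ℂ) := by
  rcases eq_or_ne v 0 with rfl | hv
  · simp [mazur_zero]
  have h : 0 < ‖v‖ := norm_pos_iff.2 hv
  have h1 : ‖v‖ ^ (s - 1) * ‖v‖ ^ (t - 1) = 1 := by
    rw [← Real.rpow_add h, show s - 1 + (t - 1) = 0 by linarith, Real.rpow_zero]
  simp only [mazur, map_mul, Complex.conj_ofReal]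
  calc _ = ((‖v‖ ^ (s - 1) * ‖v‖ ^ (t - 1) : ℝ) : ℂ) * ((starRingEnd ℂ) v * v) := by
        push_cast; ring
    _ = _ := by rw [h1, mul_comm _ v, Complex.mul_conj, Complex.normSq_eq_norm_sq]; simp

theorem MonomialAction.conj_act_mul_act {G : Type*} [Group G] (ρ : MonomialAction G X) (g : G)
    (b h : X → ℂ) (x : X) : (starRingEnd ℂ) (ρ.act g b x) * ρ.act g h x =
      (starRingEnd ℂ) (b (ρ.base g⁻¹ x)) * h (ρ.base g⁻¹ x) := by
  simp only [act, twist, fst_map, map_mul]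
  rw [mul_mul_mul_comm, ← Circle.coe_inv_eq_conj, ← Circle.coe_mul, inv_mul_cancel, Circle.coe_one,
    one_mul]

/-- The distance from a vector annihilating the invariant functionals to the Mazur image of an
invariant vector `u` is at least the norm of this image. -/
theorem MonomialAction.norm_sq_le_of_mem_dualInvariantsAnnihilator {G : Type*} [Group G]
    (ρ : MonomialAction G X) (hp : 0 < p.toReal) (hp1 : 1 < p.toReal)
    (h2 : 0 < (2 : ℝ≥0∞).toReal)
    {f a : lp (fun _ : X => ℂ) p} (hf : f ∈ dualInvariantsAnnihilator (ρ.rep p hp))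
    {u : lp (fun _ : X => ℂ) 2} (hu : u ∈ invariantVectors (ρ.rep 2 h2))
    (ha : ∀ x, a x = mazur (2 / p.toReal) (u x)) :
    ‖u‖ ^ 2 ≤ ‖a - f‖ ^ p.toReal := by
  set r := p.toReal with hr
  set r' := Real.conjExponent r with hr'
  have hrr : r.HolderConjugate r' := Real.HolderConjugate.conjExponent hp1
  let q : ℝ≥0∞ := ENNReal.ofReal r'
  have hq : q.toReal = r' := ENNReal.toReal_ofReal hrr.symm.pos.le
  have : Fact (1 ≤ q) := ⟨by
    rw [← ENNReal.ofReal_one]; exact ENNReal.ofReal_le_ofReal hrr.symm.lt.le⟩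
  have hq0 : 0 < q.toReal := by rw [hq]; exact hrr.symm.pos
  have hE := lp.hasSum_norm h2 u
  simp only [ENNReal.toReal_ofNat, Real.rpow_two] at hE
  have hbn : ∀ x, ‖mazur (2 / r') (u x)‖ ^ r' = ‖u x‖ ^ 2 := fun x => by
    rw [norm_mazur (div_pos two_pos hrr.symm.pos), ← Real.rpow_mul (norm_nonneg _),
      div_mul_cancel₀ _ hrr.symm.ne_zero, Real.rpow_two]
  -- The Mazur image of `u` in the dual exponent. It is invariant because the Mazur map commutes
  -- with the action, and it pairs with `a` to `‖u‖²` because `2 / r + 2 / r' = 2`.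
  let b : lp (fun _ : X => ℂ) q := ⟨fun x => mazur (2 / r') (u x),
    memℓp_gen (by simp only [hq, hbn]; exact hE.summable)⟩
  have hbx : ∀ x, b x = mazur (2 / r') (u x) := fun _ => rfl
  obtain ⟨φ, hφ⟩ := exists_functional (p := p) (q := q) (by rw [hq]; exact hrr) b
  have hbinv : ∀ g, ρ.act g b = b := fun g => by
    ext x
    have h3 := congrArg (fun v : lp (fun _ : X => ℂ) 2 => v x) (hu g)
    simp only [coe_rep_apply] at h3
    change ρ.act g (fun x => mazur (2 / r') (u x)) x = mazur (2 / r') (u x)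
    rw [act_mazur, h3]
  have hφinv : φ ∈ invariantVectors (dualRep (ρ.rep p hp)) := fun g => by
    ext h
    have h3 : dualRep (ρ.rep p hp) g φ h = φ ((ρ.rep p hp g).symm h) := rfl
    have h4 : (ρ.rep p hp g).symm h = ρ.rep p hp g⁻¹ h := by rw [map_inv]; rfl
    rw [h3, h4, hφ, hφ, ← (ρ.base g⁻¹⁻¹).tsum_eq fun x => (starRingEnd ℂ) (b x) * h x]
    refine tsum_congr fun x => ?_
    rw [← conj_act_mul_act, hbinv]
    rfl
  have h5 : φ f = 0 := hf φ hφinv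
  have h6 : φ a = ((‖u‖ ^ 2 : ℝ) : ℂ) := by
    rw [hφ]
    have h7 : ∀ x, (starRingEnd ℂ) (b x) * a x = ((‖u x‖ ^ 2 : ℝ) : ℂ) := fun x => by
      rw [hbx, ha, conj_mazur_mul_mazur]
      have := hrr.inv_add_inv_eq_one
      rw [div_eq_mul_inv, div_eq_mul_inv, ← mul_add, add_comm, this, mul_one]
    simp_rw [h7]
    rw [← Complex.ofReal_tsum, hE.tsum_eq]
  have h8 : ‖u‖ ^ 2 = ‖φ (a - f)‖ := by
    rw [map_sub, h5, sub_zero, h6, Complex.norm_real, Real.norm_of_nonneg (by positivity)]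
  obtain ⟨hs, -⟩ := lp.tsum_mul_le_mul_norm (p := q) (q := p) (by rw [hq]; exact hrr.symm) b (a - f)
  have hD := lp.hasSum_norm hp (a - f)
  have h9 : ‖φ (a - f)‖ ≤ ∑' x, ‖b x‖ * ‖(a - f) x‖ := by
    rw [hφ]
    refine (norm_tsum_le_tsum_norm ?_).trans_eq ?_
    · simpa using hs
    · simp
  -- Young's inequality summed over coordinates gives `‖u‖² ≤ ‖u‖² / r' + ‖a - f‖ ^ r / r`; moving
  -- the first term to the left leaves `‖u‖² / r`.
  have h10 : ∑' x, ‖b x‖ * ‖(a - f) x‖ ≤ ‖u‖ ^ 2 / r' + ‖a - f‖ ^ r / r := by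
    have hsum := (hE.div_const r').add (hD.div_const r)
    refine hasSum_le (fun x => ?_) hs.hasSum hsum
    have := Real.young_inequality_of_nonneg (norm_nonneg (b x)) (norm_nonneg ((a - f) x)) hrr.symm
    rwa [hbx, hbn] at this
  have h11 : ‖u‖ ^ 2 / r = ‖u‖ ^ 2 - ‖u‖ ^ 2 / r' := by
    have := hrr.inv_add_inv_eq_one
    have h12 : r⁻¹ = 1 - r'⁻¹ := by linarith
    rw [div_eq_mul_inv, h12, div_eq_mul_inv]; ring
  have h13 : ‖u‖ ^ 2 / r ≤ ‖a - f‖ ^ r / r := by linarith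
  exact (div_le_div_iff_of_pos_right hp).1 h13

/-- Mazur images of unit vectors in the annihilator of the invariant functionals are uniformly far
from the invariant vectors of `ℓ²`. -/
theorem MonomialAction.exists_energy_mazur_sub_invariant_ge {G : Type*} [Group G]
    (ρ : MonomialAction G X) (hp : 0 < p.toReal) (hp1 : 1 < p.toReal)
    (h2 : 0 < (2 : ℝ≥0∞).toReal) :
    ∃ κ : ℝ≥0∞, κ ≠ 0 ∧ ∀ f ∈ dualInvariantsAnnihilator (ρ.rep p hp), ‖f‖ = 1 →
      ∀ u ∈ invariantVectors (ρ.rep 2 h2),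
        κ ≤ energy 2 (fun x => mazur (p.toReal / 2) (f x) - u x) := by
  set r := p.toReal with hr
  set A : ℝ≥0∞ := 2 ^ (r - 1) with hA
  have hA0 : A ≠ 0 := (ENNReal.rpow_pos (by simp) (by simp)).ne'
  have hAt : A ≠ ⊤ := ENNReal.rpow_ne_top_of_nonneg (by linarith) (by simp)
  -- With `D` the energy of `a - f`, duality gives `energy 2 u ≤ D`, hence `1 ≤ 2 * A * D`.
  -- Continuity of the Mazur map gives `D ≤ ε * (3 + 2 * δ) + C * δ`. The choice `6 * A * ε = 1/2`
  -- leaves a positive lower bound for `δ`.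
  obtain ⟨C, hC, H⟩ := exists_energy_mazur_sub_le (t := 2 / r) (r := r) (by positivity) hp
    (ε := (2 * (A * 2 * 3))⁻¹) (ENNReal.inv_ne_zero.2 (by finiteness))
  set ε : ℝ≥0∞ := (2 * (A * 2 * 3))⁻¹ with hε
  have hεt : ε ≠ ⊤ := ENNReal.inv_ne_top.2 (by simp [hA0])
  refine ⟨(2 * (A * 2 * (2 * ε + C)))⁻¹, ENNReal.inv_ne_zero.2 (by finiteness),
    fun f hf hf1 u hu => ?_⟩
  have e1 : 2 / r * r = 2 := div_mul_cancel₀ _ hp.ne'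
  have e2 : r / 2 * 2 = r := div_mul_cancel₀ _ two_ne_zero
  have e3 : 2 / r * (r / 2) = 1 := by field_simp
  set δ := energy 2 (fun x => mazur (r / 2) (f x) - u x) with hδ
  have hfe : energy r f = 1 := by
    rw [lp.energy_eq hp, ← ofReal_norm, hf1]; simp
  have hve : energy 2 (fun x => mazur (r / 2) (f x)) = 1 := by
    rw [energy_mazur (by positivity), e2, hfe]
  have hue : energy 2 u ≤ 2 * (1 + δ) := by
    have := energy_two_sub_le (fun x => mazur (r / 2) (f x)) (fun x => mazur (r / 2) (f x) - u x)
    simp only [sub_sub_cancel] at this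
    rwa [hve] at this
  have hae : energy r (fun x => mazur (2 / r) (u x)) = energy 2 u := by
    rw [energy_mazur (by positivity), e1]
  have hut : energy 2 u ≠ ⊤ := by
    rw [energy_two_eq]; exact ENNReal.rpow_ne_top_of_nonneg (by norm_num) enorm_ne_top
  let a : lp (fun _ : X => ℂ) p := ⟨fun x => mazur (2 / r) (u x),
    (memℓp_iff_energy_ne_top hp _).2 (by rw [hae]; exact hut)⟩
  have hle := ρ.norm_sq_le_of_mem_dualInvariantsAnnihilator hp hp1 h2 hf hu (a := a) fun _ => rfl
  set D := energy r (fun x => mazur (2 / r) (u x) - f x) with hD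
  have huD : energy 2 u ≤ D := by
    have h3 : D = ‖a - f‖ₑ ^ r := lp.energy_eq hp (a - f)
    rw [h3, energy_two_eq, enorm_rpow_two, ← ofReal_norm,
      ENNReal.ofReal_rpow_of_nonneg (norm_nonneg _) hp.le]
    exact ENNReal.ofReal_le_ofReal hle
  have h1 : 1 ≤ A * 2 * D := by
    have h3 := energy_sub_le hp1.le (fun x => mazur (2 / r) (u x))
      (fun x => mazur (2 / r) (u x) - f x)
    simp only [sub_sub_cancel] at h3
    rw [hfe, hae] at h3
    calc (1 : ℝ≥0∞) ≤ A * (energy 2 u + D) := h3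
      _ ≤ A * (D + D) := by gcongr
      _ = A * 2 * D := by ring
  have hDle : D ≤ ε * (2 * (1 + δ) + 1) + C * δ := by
    have h3 := H u (fun x => mazur (r / 2) (f x))
    simp only [mazur_mazur (half_pos hp), e3, mazur_one, e1] at h3
    rw [hve] at h3
    refine h3.trans ?_
    have h4 : energy 2 (fun x => u x - mazur (r / 2) (f x)) = δ :=
      energy_congr_norm fun x => norm_sub_rev _ _
    rw [h4]
    gcongr
  have h3 : (1 : ℝ≥0∞) ≤ ε * (A * 2 * 3) + (A * 2 * (2 * ε + C)) * δ := by
    calc (1 : ℝ≥0∞) ≤ A * 2 * (ε * (2 * (1 + δ) + 1) + C * δ) := h1.trans (by gcongr)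
      _ = _ := by ring
  have h4 : ε * (A * 2 * 3) = 2⁻¹ := by
    rw [hε, ENNReal.mul_inv (by simp) (by simp), mul_assoc,
      ENNReal.inv_mul_cancel (by simp [hA0]) (by finiteness), mul_one]
  rw [h4, ← ENNReal.inv_two_add_inv_two, ENNReal.add_le_add_iff_left (by simp)] at h3
  rw [ENNReal.mul_inv (by simp) (by simp)]
  exact ENNReal.div_le_of_le_mul' h3

end Duality

/-! ### From `ℓ_p` to coset functions, and the equivalence -/

section Main

theorem isClosed_invariantVectors {G : Type*} [Group G] {E : Type*} [NormedAddCommGroup E] [NormedSpace ℂ E]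
    (π : G →* (E ≃ₗᵢ[ℂ] E)) : IsClosed (invariantVectors π : Set E) := by
  have : (invariantVectors π : Set E) = ⋂ g, {f | π g f = f} := by
    ext f; simp [invariantVectors]
  rw [this]
  exact isClosed_iInter fun g => isClosed_eq (π g).continuous continuous_id

variable {G : Type*} [Group G] [TopologicalSpace G]

/-- From almost invariant vectors of a monomial representation on `ℓ_p` to almost invariant vectors
in `ℓ²`, moved little by a given compact set. -/
theorem MonomialAction.exists_orthogonal_displacement_le {X : Type*} (ρ : MonomialAction G X)
    {p : ℝ≥0∞} [Fact (1 ≤ p)] (hp : 0 < p.toReal) (hp1 : 1 < p.toReal)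
    (h2 : 0 < (2 : ℝ≥0∞).toReal)
    (h : HasAlmostInvariantVectorsIn (ρ.rep p hp) (dualInvariantsAnnihilator (ρ.rep p hp))) :
    ∃ c : ℝ, 0 < c ∧ ∀ K : Set G, IsCompact K → ∀ δ : ℝ, 0 < δ →
      ∃ w ∈ (invariantVectors (ρ.rep 2 h2))ᗮ, c ≤ ‖w‖ ∧ ∀ g ∈ K, ‖ρ.rep 2 h2 g w - w‖ ≤ δ := by
  obtain ⟨f, hfW, hf1, hfK⟩ := h
  obtain ⟨κ, hκ0, hκ⟩ := ρ.exists_energy_mazur_sub_invariant_ge hp hp1 h2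
  obtain ⟨e, he, heκ⟩ := exists_pos_ofReal_le hκ0
  set r := p.toReal with hr
  refine ⟨√e, Real.sqrt_pos.2 he, fun K hK δ hδ => ?_⟩
  set d : ℝ≥0∞ := ENNReal.ofReal (δ ^ 2) with hd
  have hd0 : d ≠ 0 := (ENNReal.ofReal_pos.2 (by positivity)).ne'
  obtain ⟨C, hC, H⟩ := exists_energy_mazur_sub_le (t := r / 2) (r := 2) (by positivity) two_pos
    (ε := d / 4) (by simp [hd0])
  have e2 : r / 2 * 2 = r := div_mul_cancel₀ _ two_ne_zero
  have hη : (d / 2 / (C + 1)) ^ r⁻¹ ≠ 0 := by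
    refine (ENNReal.rpow_pos ?_ ?_).ne'
    · rw [pos_iff_ne_zero]; simp [hd0, hC]
    · rw [hd]; finiteness
  obtain ⟨e', he', heη⟩ := exists_pos_ofReal_le hη
  obtain ⟨n, hn⟩ := (Metric.tendstoUniformlyOn_iff.1 (hfK K hK) e' he').exists
  have hfe : energy r (f n) = 1 := by
    rw [lp.energy_eq hp, ← ofReal_norm, hf1]; simp
  have hve : energy 2 (fun x => mazur (r / 2) (f n x)) = 1 := by
    rw [energy_mazur (by positivity), e2, hfe]
  let v : lp (fun _ : X => ℂ) 2 := ⟨fun x => mazur (r / 2) (f n x),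
    (memℓp_iff_energy_ne_top h2 _).2 (by simp [hve])⟩
  have hv : ∀ g ∈ K, ‖ρ.rep 2 h2 g v - v‖ ≤ δ := fun g hg => by
    have h3 : ‖ρ.rep p hp g (f n) - f n‖ₑ ^ r ≤ d / 2 / (C + 1) := by
      have h4 : ‖ρ.rep p hp g (f n) - f n‖ₑ ≤ (d / 2 / (C + 1)) ^ r⁻¹ := by
        refine le_trans ?_ heη
        rw [← ofReal_norm]
        refine ENNReal.ofReal_le_ofReal ?_
        simpa using (hn g hg).le
      refine (ENNReal.rpow_le_rpow h4 hp.le).trans_eq ?_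
      rw [ENNReal.rpow_inv_rpow hp.ne']
    have h5 := H (ρ.act g (f n)) (f n)
    rw [e2, energy_act, hfe] at h5
    have h6 : energy r (fun x => ρ.act g (f n) x - f n x) = ‖ρ.rep p hp g (f n) - f n‖ₑ ^ r :=
      lp.energy_eq hp (ρ.rep p hp g (f n) - f n)
    have h7 : ‖ρ.rep 2 h2 g v - v‖ₑ ^ (2 : ℝ) =
        energy 2 (fun x => mazur (r / 2) (ρ.act g (f n) x) - mazur (r / 2) (f n x)) := by
      rw [← energy_two_eq]
      congr 1; ext x
      rw [← act_mazur]
      rfl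
    have h8 : ‖ρ.rep 2 h2 g v - v‖ₑ ^ (2 : ℝ) ≤ d := by
      rw [h7]
      refine h5.trans ?_
      rw [h6]
      calc _ ≤ d / 4 * (1 + 1) + (C + 1) * (d / 2 / (C + 1)) := by
            gcongr; exact le_self_add
        _ ≤ d / 2 + d / 2 := by
            gcongr
            · rw [ENNReal.div_eq_inv_mul, ENNReal.div_eq_inv_mul, mul_right_comm]
              gcongr
              rw [one_add_one_eq_two, show (4 : ℝ≥0∞) = 2 * 2 by norm_num,
                ENNReal.mul_inv (by simp) (by simp), mul_assoc,
                ENNReal.inv_mul_cancel (by simp) (by simp), mul_one]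
            · exact ENNReal.mul_div_le
        _ = d := ENNReal.add_halves d
    rw [enorm_rpow_two, hd, ENNReal.ofReal_le_ofReal_iff (by positivity)] at h8
    exact (sq_le_sq₀ (norm_nonneg _) hδ.le).1 h8
  set I := invariantVectors (ρ.rep 2 h2) with hI
  have hIc : IsComplete (I : Set (lp (fun _ : X => ℂ) 2)) := (isClosed_invariantVectors _).isComplete
  have : CompleteSpace I := hIc.completeSpace_coe
  have hu : I.starProjection v ∈ I := I.starProjection_apply_mem v
  -- Removing the invariant part leaves the displacement unchanged, and what remains has norm at
  -- least `√e` by the distance estimate.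
  refine ⟨v - I.starProjection v, I.sub_starProjection_mem_orthogonal v, ?_, fun g hg => ?_⟩
  · have h3 : κ ≤ energy 2 (fun x => mazur (r / 2) (f n x) - I.starProjection v x) :=
      hκ (f n) (hfW n) (hf1 n) _ hu
    have h4 : energy 2 (fun x => mazur (r / 2) (f n x) - I.starProjection v x) =
        ‖v - I.starProjection v‖ₑ ^ (2 : ℝ) := energy_two_eq (v - I.starProjection v)
    rw [h4, enorm_rpow_two] at h3
    have h5 := heκ.trans h3
    rw [ENNReal.ofReal_le_ofReal_iff (by positivity)] at h5
    exact Real.sqrt_le_iff.2 ⟨norm_nonneg _, h5⟩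
  · rw [map_sub, hu g]
    simpa using hv g hg

theorem HasAlmostInvariantCosetFunctions.of_not_propertyTlp [IsTopologicalGroup G]
    [LocallyCompactSpace G] [TotallyDisconnectedSpace G] {U : Subgroup G}
    (hU : IsCompact (U : Set G)) {p : ℝ≥0∞} [Fact (1 ≤ p)] (hp1 : 1 < p) (hpt : p < ⊤)
    (hp2 : p ≠ 2) (h : ¬ PropertyTlp G p) : HasAlmostInvariantCosetFunctions U := by
  intro S ε hε
  have hr1 : 1 < p.toReal := by
    rw [← ENNReal.toReal_one]; exact ENNReal.toReal_strict_mono hpt.ne hp1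
  have hr : 0 < p.toReal := by linarith
  have hr2 : p.toReal ≠ 2 := fun h => hp2 (by
    rw [← ENNReal.ofReal_toReal hpt.ne, h]; simp)
  have h2 : 0 < (2 : ℝ≥0∞).toReal := by norm_num
  simp only [PropertyTlp, PropertyTB, not_forall, not_not] at h
  obtain ⟨π, hsc, hπ⟩ := h
  obtain ⟨ρ, rfl⟩ := exists_eq_rep hr hpt.ne hr2 π
  obtain ⟨c, hc, H⟩ := ρ.exists_orthogonal_displacement_le hr hr1 h2 hπ
  -- The quarter absorbs the factor `4` of `exists_coset_function_of_act`; the minimum with `1`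
  -- keeps the constant finite, as required there.
  have hε0 : min ε 1 / 4 ≠ 0 := by simp [hε]
  obtain ⟨δ, hδ, hfix⟩ := exists_fixed_displacement_lt (ρ.rep 2 h2) U
    (invariantVectors (ρ.rep 2 h2))ᗮ (Submodule.isClosed_orthogonal _)
    (map_mem_invariantVectors_orthogonal _) S hε0 hc
  obtain ⟨w, hw, hcw, hwK⟩ := H (U ∪ S) (hU.union S.finite_toSet.isCompact) δ hδ
  obtain ⟨v, hv, hvU, hvS⟩ := hfix w hw hcw (fun u hu => hwK u (Or.inl hu))
    (fun s hs => hwK s (Or.inr hs))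
  have hlt : ∑ s ∈ S, energy 2 (fun x => ρ.act s v x - v x) < min ε 1 / 4 * energy 2 v := by
    rw [energy_two_eq]
    exact lt_of_eq_of_lt (Finset.sum_congr rfl fun s _ => energy_two_eq (ρ.rep 2 h2 s v - v)) hvS
  obtain ⟨K, f, hf1, hf2, hf3, hf4⟩ := ρ.exists_coset_function_of_act
    (ρ.isOpen_stabilizer hr hsc) U S
    (ENNReal.div_ne_top (ne_top_of_le_ne_top ENNReal.one_ne_top (min_le_right _ _)) (by simp)) v
    (fun u hu => congrArg (fun w : lp (fun _ : ℕ => ℂ) 2 => (w : ℕ → ℂ)) (hvU u hu))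
    (by rw [energy_two_eq]; exact ENNReal.rpow_ne_top_of_nonneg (by norm_num) enorm_ne_top)
    (fun y hy => ρ.tsum_orbit_twist_eq_zero h2 hv hy) hlt
  refine ⟨K, f, hf1, hf2, hf3, hf4.trans_le ?_⟩
  gcongr
  rw [ENNReal.mul_div_cancel (by simp) (by simp)]
  exact min_le_left _ _

end Main

theorem theorem2 (G : Type*) [Group G] [TopologicalSpace G] [IsTopologicalGroup G]
    [LocallyCompactSpace G] [SecondCountableTopology G] [TotallyDisconnectedSpace G] :
    List.TFAE
      [∃ (p : ℝ≥0∞) (_ : Fact (1 ≤ p)), 1 < p ∧ p < ∞ ∧ p ≠ 2 ∧ PropertyTlp G p,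
       ∀ (p : ℝ≥0∞) [Fact (1 ≤ p)], 1 < p → p < ∞ → p ≠ 2 → PropertyTlp G p,
       PropertyTR fun H : OpenSubgroup G => quasiRegularRep (H : Subgroup G)] := by
  -- Compactness of `U` is used to make vectors `U`-fixed, openness to pass from finite to compact
  -- sets.
  obtain ⟨U, hU, -⟩ := exists_openSubgroup_subset_of_mem_nhds (G := G) Filter.univ_mem
  tfae_have 1 → 3 := by
    rintro ⟨p, _, hp1, hpt, -, hT⟩
    by_contra h
    exact (HasAlmostInvariantCosetFunctions.of_not_propertyTR hU h).not_propertyTlp U.isOpen hp1 hpt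
      hT
  tfae_have 3 → 2 := by
    intro h p _ hp1 hpt hp2
    by_contra hT
    exact (HasAlmostInvariantCosetFunctions.of_not_propertyTlp hU hp1 hpt hp2 hT).not_propertyTR
      U.isOpen h
  tfae_have 2 → 1 := by
    intro h
    have h3 : (1 : ℝ≥0∞) < 3 := by norm_num
    have : Fact ((1 : ℝ≥0∞) ≤ 3) := ⟨h3.le⟩
    exact ⟨3, this, h3, by simp, by norm_num, h 3 h3 (by simp) (by norm_num)⟩
  tfae_finish
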